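/- Let $K$ be a metric simplicial complex combinatorially equivalent to the regular octahedron, with vertices $v_1,\dots,v_6$ in which exactly the pairs $v_2v_4$, $v_3v_5$, $v_1v_6$ (the diagonals) are not joined by an edge. Denote the edge lengths by $$p=v_1v_2,\quad q=v_1v_3,\quad r=v_1v_4,\quad s=v_1v_5,\qquad c=v_2v_3,\quad f=v_3v_4,\quad h=v_4v_5,\quad g=v_5v_2,$$ $$b=v_6v_2,\quad a=v_6v_3,\quad e=v_6v_4,\quad d=v_6v_5;$$ they are positive and satisfy the strict triangle inequalities on all eight faces. A nontrivial flex of $K$ is a continuous family of isometric realizations $P_t:K\to\mathbb{R}^3$, $t\in[0,1]$ (self-intersections allowed), along which the lengths of all three diagonals vary with $t$, i.e. none of the three is constant on a subinterval of $[0,1]$ of positive length. $K$ is called nontrivially flexible if it has a nontrivial flex. The equators are the edge cycles with consecutive lengths $(c,f,h,g)$, $(b,p,r,e)$, $(s,q,a,d)$. An equator with consecutive edge lengths $(w,x,y,z)$ is metrically symmetric if $w=y,\ x=z$, or $w=x,\ y=z$, or $w=z,\ x=y$; it has zero sum if $(w+x-y-z)(w-x+y-z)(w-x-y+z)=0$.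 Put $$\begin{aligned}B_{\varepsilon_1,\varepsilon_2,\varepsilon_3}={}&abc(h^2+s^2+r^2)-hsr(a^2+b^2+c^2)\\&+\varepsilon_1\bigl(csb(h^2+r^2-s^2)-hra(b^2+c^2-a^2)\bigr)\\&+\varepsilon_2\bigl(ahb(s^2+r^2-h^2)-src(a^2+b^2-c^2)\bigr)\\&+\varepsilon_3\bigl(cra(s^2+h^2-r^2)-shb(a^2+c^2-b^2)\bigr).\end{aligned}$$ Theorem. Every nontrivially flexible octahedron $K$ is of type A or of type B, where * type A means that all three equators are metrically symmetric; * type B means that all three equators have zero sum, that $qge=pfd$, $bhq=cdr$, $rga=sfb$, and that $B_{1,1,1}\cdot B_{1,-1,-1}\cdot B_{-1,1,-1}\cdot B_{-1,-1,1}=0$. -/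

import Mathlib

/-- The metric of a simplicial complex combinatorially equivalent to the regular octahedron.
The vertices are `v₁, …, v₆`; the pairs `v₂v₄`, `v₃v₅`, `v₁v₆` are not joined by edges.  The edges are

* `p = v₁v₂`, `q = v₁v₃`, `r = v₁v₄`, `s = v₁v₅`,
* `c = v₂v₃`, `f = v₃v₄`, `h = v₄v₅`, `g = v₅v₂`,
* `b = v₆v₂`, `a = v₆v₃`, `e = v₆v₄`, `d = v₆v₅`.

The lengths are positive and satisfy the strict triangle inequalities on the eight faces
`pqc`, `qrf`, `rsh`, `spg`, `bac`, `aef`, `edh`, `dbg`. -/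
structure OctahedronMetric where
  a : ℝ
  b : ℝ
  c : ℝ
  d : ℝ
  e : ℝ
  f : ℝ
  g : ℝ
  h : ℝ
  p : ℝ
  q : ℝ
  r : ℝ
  s : ℝ
  pos : 0 < a ∧ 0 < b ∧ 0 < c ∧ 0 < d ∧ 0 < e ∧ 0 < f ∧
    0 < g ∧ 0 < h ∧ 0 < p ∧ 0 < q ∧ 0 < r ∧ 0 < s
  face_pqc : p < q + c ∧ q < p + c ∧ c < p + q
  face_qrf : q < r + f ∧ r < q + f ∧ f < q + r
  face_rsh : r < s + h ∧ s < r + h ∧ h < r + s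
  face_spg : s < p + g ∧ p < s + g ∧ g < s + p
  face_bac : b < a + c ∧ a < b + c ∧ c < b + a
  face_aef : a < e + f ∧ e < a + f ∧ f < a + e
  face_edh : e < d + h ∧ d < e + h ∧ h < e + d
  face_dbg : d < b + g ∧ b < d + g ∧ g < d + b

namespace OctahedronMetric

/-- `P` lists the images of `v₁, …, v₆` (`P 0` is the image of `v₁`, …, `P 5` that of `v₆`) under an
isometric realization of the complex in `ℝ³`; being affine on faces, the realization is determined
by these points.  Self-intersections are allowed. -/
def IsRealization (K : OctahedronMetric) (P : Fin 6 → EuclideanSpace ℝ (Fin 3)) : Prop :=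
  dist (P 0) (P 1) = K.p ∧ dist (P 0) (P 2) = K.q ∧
  dist (P 0) (P 3) = K.r ∧ dist (P 0) (P 4) = K.s ∧
  dist (P 1) (P 2) = K.c ∧ dist (P 2) (P 3) = K.f ∧
  dist (P 3) (P 4) = K.h ∧ dist (P 4) (P 1) = K.g ∧
  dist (P 5) (P 1) = K.b ∧ dist (P 5) (P 2) = K.a ∧
  dist (P 5) (P 3) = K.e ∧ dist (P 5) (P 4) = K.d

/-- The real function `φ` on `[0, 1]` varies with `t`: it is constant on no subinterval of
positive length. -/
def VariesOnUnitInterval (φ : ℝ → ℝ) : Prop :=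
  ∀ u v : ℝ, 0 ≤ u → u < v → v ≤ 1 → ∃ t ∈ Set.Icc u v, φ t ≠ φ u

/-- `P t`, `t ∈ [0, 1]`, is a nontrivial flex of the metric complex `K`: a continuous family of
isometric realizations along which all three diagonals `v₂v₄`, `v₃v₅`, `v₁v₆` vary. -/
structure IsNontrivialFlex (K : OctahedronMetric)
    (P : ℝ → Fin 6 → EuclideanSpace ℝ (Fin 3)) : Prop where
  continuousOn : ContinuousOn P (Set.Icc 0 1)
  isRealization : ∀ t ∈ Set.Icc (0 : ℝ) 1, K.IsRealization (P t)
  varies_x : VariesOnUnitInterval fun t => dist (P t 1) (P t 3)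
  varies_y : VariesOnUnitInterval fun t => dist (P t 2) (P t 4)
  varies_z : VariesOnUnitInterval fun t => dist (P t 0) (P t 5)

/-- `K` is the metric of a nontrivially flexible octahedron. -/
def NontriviallyFlexible (K : OctahedronMetric) : Prop :=
  ∃ P : ℝ → Fin 6 → EuclideanSpace ℝ (Fin 3), K.IsNontrivialFlex P

/-- An equator with consecutive edge lengths `w, x, y, z` is metrically symmetric. -/
def EquatorSymmetric (w x y z : ℝ) : Prop :=
  (w = y ∧ x = z) ∨ (w = x ∧ y = z) ∨ (w = z ∧ x = y)

/-- An equator with consecutive edge lengths `w, x, y, z` has zero sum. -/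
def EquatorZeroSum (w x y z : ℝ) : Prop :=
  (w + x - y - z) * (w - x + y - z) * (w - x - y + z) = 0

/-- The polynomial `B_{ε₁,ε₂,ε₃}` in the edges of the opposite faces `abc` and `hsr`. -/
def B (K : OctahedronMetric) (ε₁ ε₂ ε₃ : ℝ) : ℝ :=
  K.a * K.b * K.c * (K.h ^ 2 + K.s ^ 2 + K.r ^ 2)
    - K.h * K.s * K.r * (K.a ^ 2 + K.b ^ 2 + K.c ^ 2)
    + ε₁ * (K.c * K.s * K.b * (K.h ^ 2 + K.r ^ 2 - K.s ^ 2)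
      - K.h * K.r * K.a * (K.b ^ 2 + K.c ^ 2 - K.a ^ 2))
    + ε₂ * (K.a * K.h * K.b * (K.s ^ 2 + K.r ^ 2 - K.h ^ 2)
      - K.s * K.r * K.c * (K.a ^ 2 + K.b ^ 2 - K.c ^ 2))
    + ε₃ * (K.c * K.r * K.a * (K.s ^ 2 + K.h ^ 2 - K.r ^ 2)
      - K.s * K.h * K.b * (K.a ^ 2 + K.c ^ 2 - K.b ^ 2))

/-- Type A: the three equators `cfhg`, `bpre`, `sqad` are metrically symmetric. -/
def TypeA (K : OctahedronMetric) : Prop :=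
  EquatorSymmetric K.c K.f K.h K.g ∧ EquatorSymmetric K.b K.p K.r K.e ∧
    EquatorSymmetric K.s K.q K.a K.d

/-- Type B: the three equators have zero sum, the three proportionality relations hold, and one of
the four polynomials `B` vanishes. -/
def TypeB (K : OctahedronMetric) : Prop :=
  (EquatorZeroSum K.c K.f K.h K.g ∧ EquatorZeroSum K.b K.p K.r K.e ∧
    EquatorZeroSum K.s K.q K.a K.d) ∧
  (K.q * K.g * K.e = K.p * K.f * K.d ∧ K.b * K.h * K.q = K.c * K.d * K.r ∧
    K.r * K.g * K.a = K.s * K.f * K.b) ∧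
  K.B 1 1 1 * K.B 1 (-1) (-1) * K.B (-1) 1 (-1) * K.B (-1) (-1) 1 = 0

end OctahedronMetric

/-!
Each vertex of the octahedron is joined to the four vertices of an equator, whose two diagonals
are tied by the vanishing of a Gram determinant of four unit vectors in `ℝ³`. A nontrivial flex,
read through an ultrafilter on the parameter interval, yields a field extension of `ℝ` in which the
squared diagonals `x`, `y`, `z` are transcendental and satisfy the six Gram relations, two for each
pair of diagonals. The relations at opposite vertices are quadratic in either diagonal, so they
are controlled by the position of the subfields `ℝ(x)`, `ℝ(y)`, `ℝ(z)`. If `x ∉ ℝ(z)`, the two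
relations between `x` and `z` are proportional over `ℝ(z)`; comparing the places where they
degenerate forces symmetric equators, and type A results unless all three fields agree. If they
agree, then opposite face angles at each vertex are equal or supplementary and every relation
degenerates to `(x - x₀)(z - z₀) = k`. Equality of the poles computed at opposite vertices gives the
zero sums, the law of sines gives the monomial equalities, and composing the three Möbius maps to
the identity gives the sign under which one of the polynomials `B` must vanish.
-/

open Polynomial IntermediateField

universe u v

/-- Evaluate along an ultrafilter containing the residual sets: a polynomial relation for `f` would
force `f` to take one of finitely many values on a non-meagre set. -/
theorem exists_field_transcendental (T : Type u) (𝕜 : Type v) [TopologicalSpace T] [BaireSpace T]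
    [Nonempty T] [Field 𝕜] [TopologicalSpace 𝕜] [T1Space 𝕜] :
    ∃ (L : Type (max u v)) (_ : Field L) (_ : Algebra 𝕜 L) (φ : (T → 𝕜) →ₐ[𝕜] L),
      ∀ f : T → 𝕜, Continuous f → (∀ k, Dense {t | f t ≠ k}) → Transcendental 𝕜 (φ f) := by
  classical
  have : (residual T).NeBot :=
    Filter.forall_mem_nonempty_iff_neBot.1 fun s hs => (dense_of_mem_residual hs).nonempty
  let U : Ultrafilter T := Ultrafilter.of (residual T)
  let ψ : (T → 𝕜) →+* (U : Filter T).Germ 𝕜 := Filter.Germ.coeRingHom _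
  let algebra : Algebra 𝕜 ((U : Filter T).Germ 𝕜) := (ψ.comp (Pi.constRingHom T 𝕜)).toAlgebra
  let φ : (T → 𝕜) →ₐ[𝕜] (U : Filter T).Germ 𝕜 := { ψ with commutes' := fun _ => rfl }
  refine ⟨(U : Filter T).Germ 𝕜, inferInstance, algebra, φ, fun f hf hdense => ?_⟩
  refine transcendental_iff.2 fun p hp => by_contra fun hp0 => ?_
  rw [aeval_algHom_apply] at hp
  have eval_eq_zero : ∀ᶠ t in (U : Filter T), aeval f p t = 0 := Filter.Germ.coe_eq.1 hp
  have ne_roots : ∀ᶠ t in (U : Filter T), ∀ k ∈ p.roots.toFinset, f t ≠ k :=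
    (Filter.eventually_all_finset _).2 fun k _ => Ultrafilter.of_le _ <|
      residual_of_dense_open (isOpen_compl_singleton.preimage hf) (hdense k)
  obtain ⟨t, ht, ht'⟩ := (eval_eq_zero.and ne_roots).exists
  refine ht' (f t) ?_ rfl
  simpa [hp0] using ht

section TranscendentalElements

variable {F L : Type*} [Field F] [Field L] [Algebra F L] {x z : L}

theorem aeval_mem_adjoin_simple (z : L) (p : F[X]) : aeval z p ∈ F⟮z⟯ :=
  algebra_adjoin_le_adjoin _ _ (aeval_mem_adjoin_singleton _ _)

theorem ne_algebraMap_of_transcendental (hz : Transcendental F z) (k : F) :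
    z ≠ algebraMap F L k := by
  rintro rfl
  exact hz (isAlgebraic_algebraMap k)

theorem sq_sub_one_ne_zero_of_transcendental (hz : Transcendental F z) : z ^ 2 - 1 ≠ 0 := by
  intro h
  rcases sq_eq_one_iff.1 (sub_eq_zero.1 h) with h | h
  · exact ne_algebraMap_of_transcendental hz 1 (by rw [h, map_one])
  · exact ne_algebraMap_of_transcendental hz (-1) (by rw [h, map_neg, map_one])

theorem coeff_eq_zero_of_quadratic_eq_zero (hz : Transcendental F z) {a b c : F}
    (h : algebraMap F L a * z ^ 2 + algebraMap F L b * z + algebraMap F L c = 0) :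
    a = 0 ∧ b = 0 ∧ c = 0 := by
  have hp : (C a * X ^ 2 + C b * X + C c : F[X]) = 0 :=
    transcendental_iff.1 hz _ (by simpa [aeval_C] using h)
  refine ⟨?_, ?_, ?_⟩
  · simpa [coeff_X, coeff_C] using congrArg (fun p : F[X] => p.coeff 2) hp
  · simpa [coeff_X, coeff_C] using congrArg (fun p : F[X] => p.coeff 1) hp
  · simpa [coeff_X, coeff_C] using congrArg (fun p : F[X] => p.coeff 0) hp

theorem mem_of_mul_add_eq_zero {S : IntermediateField F L} {a b : L} (ha : a ∈ S) (hb : b ∈ S)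
    (ha0 : a ≠ 0) (h : a * x + b = 0) : x ∈ S := by
  have hx : x = -b / a := by
    field_simp
    linear_combination h
  exact hx ▸ div_mem (neg_mem hb) ha

theorem bilinear_relation_unique (hz : Transcendental F z) {m n k m' n' k' : F} (hk : k ≠ 0)
    (h : (x - algebraMap F L m) * (z - algebraMap F L n) = algebraMap F L k)
    (h' : (x - algebraMap F L m') * (z - algebraMap F L n') = algebraMap F L k') :
    m = m' ∧ n = n' ∧ k = k' := by
  obtain ⟨h₂, h₁, h₀⟩ := coeff_eq_zero_of_quadratic_eq_zero hz (a := m - m')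
    (b := (m' - m) * (n + n') + (k - k')) (c := (m - m') * n * n' + k' * n - k * n')
    (by simp only [map_sub, map_mul, map_add]
        linear_combination (z - algebraMap F L n) * h' - (z - algebraMap F L n') * h)
  have hkk' : k = k' := by linear_combination h₁ + (n + n') * h₂
  refine ⟨sub_eq_zero.1 h₂, mul_left_cancel₀ hk ?_, hkk'⟩
  linear_combination h₀ - n * n' * h₂ + n * hkk'

theorem isRoot_of_mul_eq_sq {w : L} (hz : Transcendental F z) (hw : w ∈ F⟮z⟯) {G H : F[X]}
    (h : w ^ 2 = aeval z (G * H)) {ρ : F} (hρ : G.IsRoot ρ) (hρ' : ¬(derivative G).IsRoot ρ) :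
    H.IsRoot ρ := by
  have hG : G ≠ 0 := by
    rintro rfl
    simp at hρ'
  rcases eq_or_ne H 0 with rfl | hH
  · simp
  have hGH : G * H ≠ 0 := mul_ne_zero hG hH
  obtain ⟨r, s, rfl⟩ := (mem_adjoin_simple_iff F w).1 hw
  have hs : s ≠ 0 := by
    rintro rfl
    exact hGH (transcendental_iff.1 hz _ (by rw [← h]; simp))
  have key : r ^ 2 = s ^ 2 * (G * H) := by
    apply transcendental_iff_injective.1 hz
    have hs' : aeval z s ≠ 0 := fun h0 => hs (transcendental_iff.1 hz s h0)
    rw [map_pow, map_mul, map_pow, ← h]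
    field_simp
  have hr : r ≠ 0 := by
    rintro rfl
    exact mul_ne_zero (pow_ne_zero 2 hs) hGH (by rw [← key]; simp)
  have parity := congrArg (rootMultiplicity ρ) key
  rw [rootMultiplicity_mul (by positivity), rootMultiplicity_mul hGH, sq, sq,
    rootMultiplicity_mul (mul_ne_zero hr hr), rootMultiplicity_mul (mul_ne_zero hs hs)] at parity
  have hG₁ : rootMultiplicity ρ G = 1 := by
    refine le_antisymm (not_lt.1 fun h1 => hρ' ?_) ((rootMultiplicity_pos hG).2 hρ)
    exact ((one_lt_rootMultiplicity_iff_isRoot hG).1 h1).2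
  rw [← rootMultiplicity_pos hH]
  omega

theorem isRoot_of_aeval_mul_sub_mul_eq_zero (hz : Transcendental F z) {p₁ p₀ q₁ q₀ : F[X]}
    (h : aeval z (p₁ * q₀ - q₁ * p₀) = 0) {ρ : F} (hp₁ : p₁.IsRoot ρ) (hq₁ : ¬q₁.IsRoot ρ) :
    p₀.IsRoot ρ := by
  have hρ := congrArg (eval ρ) (transcendental_iff.1 hz _ h)
  rw [eval_sub, eval_mul, eval_mul, hp₁.eq_zero, eval_zero, zero_mul, zero_sub, neg_eq_zero] at hρ
  exact (mul_eq_zero.1 hρ).resolve_left hq₁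

theorem isRoot_of_linear_of_linear (hz : Transcendental F z) {p₁ p₀ q₁ q₀ : F[X]}
    (hp : aeval z p₁ * x + aeval z p₀ = 0) (hq : aeval z q₁ * x + aeval z q₀ = 0)
    {ρ : F} (hp₁ : p₁.IsRoot ρ) (hq₁ : ¬q₁.IsRoot ρ) : p₀.IsRoot ρ := by
  refine isRoot_of_aeval_mul_sub_mul_eq_zero hz (q₀ := q₀) ?_ hp₁ hq₁
  simp only [map_sub, map_mul]
  linear_combination aeval z p₁ * hq - aeval z q₁ * hp

theorem isRoot_of_quadratic_of_quadratic (hz : Transcendental F z) (hx : x ∉ F⟮z⟯)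
    {p₂ p₁ p₀ q₂ q₁ q₀ : F[X]} (hp : aeval z p₂ * x ^ 2 + aeval z p₁ * x + aeval z p₀ = 0)
    (hq : aeval z q₂ * x ^ 2 + aeval z q₁ * x + aeval z q₀ = 0)
    {ρ : F} (hp₂ : p₂.IsRoot ρ) (hq₂ : ¬q₂.IsRoot ρ) : p₁.IsRoot ρ ∧ p₀.IsRoot ρ := by
  have hlin : aeval z (p₂ * q₁ - q₂ * p₁) * x + aeval z (p₂ * q₀ - q₂ * p₀) = 0 := by
    simp only [map_sub, map_mul]
    linear_combination aeval z p₂ * hq - aeval z q₂ * hp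
  have h₁ : aeval z (p₂ * q₁ - q₂ * p₁) = 0 := by_contra fun h =>
    hx (mem_of_mul_add_eq_zero (aeval_mem_adjoin_simple _ _) (aeval_mem_adjoin_simple _ _) h hlin)
  have h₀ : aeval z (p₂ * q₀ - q₂ * p₀) = 0 := by simpa [h₁] using hlin
  exact ⟨isRoot_of_aeval_mul_sub_mul_eq_zero hz h₁ hp₂ hq₂,
    isRoot_of_aeval_mul_sub_mul_eq_zero hz h₀ hp₂ hq₂⟩

end TranscendentalElements

section SphericalGram

variable {R : Type*} [CommRing R]

/-- The Gram determinant of the vertices of a spherical quadrilateral, `α, β, γ, δ` being the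
cosines of its consecutive sides and `X`, `Z` those of its diagonals. -/
def sphericalGram (α β γ δ X Z : R) : R :=
  Matrix.det !![1, α, X, δ; α, 1, β, Z; X, β, 1, γ; δ, Z, γ, 1]

theorem sphericalGram_eq (α β γ δ X Z : R) : sphericalGram α β γ δ X Z =
    (Z ^ 2 - 1) * X ^ 2 + 2 * (α * β + γ * δ - (α * γ + β * δ) * Z) * X
      + (2 * (α * δ + β * γ) * Z - Z ^ 2 + 1 - α ^ 2 - β ^ 2 - γ ^ 2 - δ ^ 2
        + (α * γ - β * δ) ^ 2) := by
  rw [sphericalGram, Matrix.det_succ_row_zero]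
  simp only [Fin.sum_univ_four, Matrix.det_fin_three, Matrix.submatrix_apply]
  change (-1) ^ 0 * 1 * (1 * 1 * 1 - 1 * γ * γ - β * β * 1 + β * γ * Z + Z * β * γ - Z * 1 * Z)
    + (-1) ^ 1 * α * (α * 1 * 1 - α * γ * γ - β * X * 1 + β * γ * δ + Z * X * γ - Z * 1 * δ)
    + (-1) ^ 2 * X * (α * β * 1 - α * γ * Z - 1 * X * 1 + 1 * γ * δ + Z * X * Z - Z * β * δ)
    + (-1) ^ 3 * δ * (α * β * γ - α * 1 * Z - 1 * X * γ + 1 * 1 * δ + β * X * Z - β * β * δ) = _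
  ring

theorem sphericalGram_rotate (α β γ δ X Z : R) :
    sphericalGram β γ δ α Z X = sphericalGram α β γ δ X Z := by
  simp only [sphericalGram_eq]
  ring

theorem map_sphericalGram {S : Type*} [CommRing S] (φ : R →+* S) (α β γ δ X Z : R) :
    φ (sphericalGram α β γ δ X Z) = sphericalGram (φ α) (φ β) (φ γ) (φ δ) (φ X) (φ Z) := by
  simp only [sphericalGram_eq, map_add, map_sub, map_mul, map_pow, map_one, map_ofNat]

theorem sphericalGram_isogram {ε : R} (hε : ε ^ 2 = 1) (γ δ X Z : R) :
    sphericalGram (ε * γ) (ε * δ) γ δ X Z =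
      ((X + 1) * (Z + ε) - ε * (γ + δ) ^ 2) * ((X - 1) * (Z - ε) - ε * (γ - δ) ^ 2) := by
  rw [sphericalGram_eq]
  linear_combination (X ^ 2 - 1 + γ ^ 2 + δ ^ 2 - 2 * X * γ * δ) * hε

theorem sphericalGram_deltoid {κ : R} (hκ : κ ^ 2 = 1) (β γ X Z : R) :
    sphericalGram (κ * β) β γ (κ * γ) X Z =
      (κ * X - 1) * ((κ * X + 1) * (Z ^ 2 - 1) - (4 * β * γ * Z - 2 * (β ^ 2 + γ ^ 2))) := by
  rw [sphericalGram_eq]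
  linear_combination (X ^ 2 * (1 - Z ^ 2) + 2 * β * γ * Z - β ^ 2 - γ ^ 2) * hκ

end SphericalGram

theorem exists_sign_of_mul_eq_of_sq_add_sq_eq {F : Type*} [Field F] [CharZero F] {α β γ δ : F}
    (hmul : α * δ = β * γ) (hsq : α ^ 2 + δ ^ 2 = β ^ 2 + γ ^ 2) :
    (∃ κ : F, κ ^ 2 = 1 ∧ α = κ * β ∧ δ = κ * γ) ∨
      ∃ ε : F, ε ^ 2 = 1 ∧ α = ε * γ ∧ β = ε * δ := by
  have hadd : (α + δ) ^ 2 = (β + γ) ^ 2 := by linear_combination hsq + 2 * hmul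
  have hsub : (α - δ) ^ 2 = (β - γ) ^ 2 := by linear_combination hsq - 2 * hmul
  rcases sq_eq_sq_iff_eq_or_eq_neg.1 hadd with h | h <;>
    rcases sq_eq_sq_iff_eq_or_eq_neg.1 hsub with h' | h'
  · exact .inl ⟨1, one_pow 2, by linear_combination (h + h') / 2,
      by linear_combination (h - h') / 2⟩
  · exact .inr ⟨1, one_pow 2, by linear_combination (h + h') / 2,
      by linear_combination (h' - h) / 2⟩
  · exact .inr ⟨-1, by norm_num, by linear_combination (h + h') / 2,
      by linear_combination (h - h') / 2⟩
  · exact .inl ⟨-1, by norm_num, by linear_combination (h + h') / 2,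
      by linear_combination (h - h') / 2⟩

theorem eq_mul_of_sphericalGram_eq_zero {α β γ δ μ : ℝ} (hμ : μ ^ 2 = 1) (hγ : γ ^ 2 < 1)
    (hδ : δ ^ 2 < 1) (h : ∀ X, sphericalGram α β γ δ X μ = 0) : α = μ * δ ∧ β = μ * γ := by
  simp only [sphericalGram_eq] at h
  have hprod : (α - μ * δ) * (β - μ * γ) = 0 := by
    linear_combination (h 1 - h 0) / 2 + (γ * δ - 1 / 2) * hμ
  have hsum : (α * γ - β * δ) ^ 2 = (α - μ * δ) ^ 2 + (β - μ * γ) ^ 2 := by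
    linear_combination h 0 + (1 - δ ^ 2 - γ ^ 2) * hμ
  rcases mul_eq_zero.1 hprod with hα | hβ
  · have hβ : (1 - δ ^ 2) * (β - μ * γ) ^ 2 = 0 := by
      rw [sub_eq_zero.1 hα] at hsum
      linear_combination -hsum
    have := pow_eq_zero_iff two_ne_zero |>.1 ((mul_eq_zero.1 hβ).resolve_left (by linarith))
    exact ⟨sub_eq_zero.1 hα, sub_eq_zero.1 this⟩
  · have hα : (1 - γ ^ 2) * (α - μ * δ) ^ 2 = 0 := by
      rw [sub_eq_zero.1 hβ] at hsum
      linear_combination -hsum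
    have := pow_eq_zero_iff two_ne_zero |>.1 ((mul_eq_zero.1 hα).resolve_left (by linarith))
    exact ⟨sub_eq_zero.1 this, sub_eq_zero.1 hβ⟩

/-- As a quadratic equation for `X`, the Gram relation has discriminant `4 G H`. It is a square in
`ℝ(Z)`, so the two roots of `G`, which are simple, are also the roots of `H`. -/
theorem deltoid_or_isogram_of_mem_adjoin {L : Type*} [Field L] [Algebra ℝ L] {α β γ δ : ℝ}
    (hα : α ^ 2 < 1) (hδ : δ ^ 2 < 1) {X Z : L} (hZ : Transcendental ℝ Z)
    (h : sphericalGram (algebraMap ℝ L α) (algebraMap ℝ L β) (algebraMap ℝ L γ)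
      (algebraMap ℝ L δ) X Z = 0) (hX : X ∈ ℝ⟮Z⟯) :
    (∃ κ : ℝ, κ ^ 2 = 1 ∧ α = κ * β ∧ δ = κ * γ) ∨
      ∃ ε : ℝ, ε ^ 2 = 1 ∧ α = ε * γ ∧ β = ε * δ := by
  let G : ℝ[X] := C (1 - α ^ 2 - δ ^ 2) + C (2 * α * δ) * Polynomial.X - Polynomial.X ^ 2
  let H : ℝ[X] := C (1 - β ^ 2 - γ ^ 2) + C (2 * β * γ) * Polynomial.X - Polynomial.X ^ 2
  let W : L := (Z ^ 2 - 1) * X + algebraMap ℝ L (α * β + γ * δ)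
    - algebraMap ℝ L (α * γ + β * δ) * Z
  have hW : W ∈ ℝ⟮Z⟯ :=
    have hZmem : Z ∈ ℝ⟮Z⟯ := mem_adjoin_simple_self ℝ Z
    sub_mem (add_mem (mul_mem (sub_mem (pow_mem hZmem 2) (one_mem _)) hX)
      (_root_.algebraMap_mem _ _)) (mul_mem (_root_.algebraMap_mem _ _) hZmem)
  have hWsq : W ^ 2 = aeval Z (G * H) := by
    rw [sphericalGram_eq] at h
    simp only [W, G, H, map_mul, map_sub, map_add, map_pow, map_one, map_ofNat, aeval_X, aeval_C]
    linear_combination (Z ^ 2 - 1) * h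
  have root_H : ∀ ρ : ℝ, 1 - α ^ 2 - δ ^ 2 + 2 * α * δ * ρ - ρ ^ 2 = 0 → 2 * α * δ - 2 * ρ ≠ 0 →
      1 - β ^ 2 - γ ^ 2 + 2 * β * γ * ρ - ρ ^ 2 = 0 := by
    intro ρ hρ hρ'
    simpa [H, IsRoot] using isRoot_of_mul_eq_sq hZ hW hWsq (ρ := ρ)
      (by simpa [G, IsRoot] using hρ) (by simpa [G, IsRoot, derivative_pow] using hρ')
  have hpos : 0 < (1 - α ^ 2) * (1 - δ ^ 2) := mul_pos (by linarith) (by linarith)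
  obtain ⟨m, hm0, hm⟩ : ∃ m : ℝ, 0 < m ∧ m ^ 2 = (1 - α ^ 2) * (1 - δ ^ 2) :=
    ⟨_, Real.sqrt_pos.2 hpos, Real.sq_sqrt hpos.le⟩
  have root_add := root_H (α * δ + m) (by linear_combination -hm) (by intro h; linarith)
  have root_sub := root_H (α * δ - m) (by linear_combination -hm) (by intro h; linarith)
  have hmul : α * δ = β * γ :=
    mul_left_cancel₀ hm0.ne' (by linear_combination (-1 / 4) * (root_add - root_sub))
  refine exists_sign_of_mul_eq_of_sq_add_sq_eq hmul ?_
  linear_combination (1 / 2) * (root_add + root_sub) + hm + 2 * (α * δ) * hmul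

section CosOfSq

variable {A : Type*} [CommRing A] [Algebra ℝ A] {L : Type*} [Field L] [Algebra ℝ L] {u v : ℝ}

/-- The law of cosines: the cosine of the angle between the sides `u` and `v` of a triangle, `x`
being the square of the third side. The square takes values in an arbitrary real algebra, so that it
can be a number, a function of time, an indeterminate or a transcendental element. -/
noncomputable def cosOfSq (u v : ℝ) (x : A) : A :=
  (2 * u * v)⁻¹ • (algebraMap ℝ A (u ^ 2 + v ^ 2) - x)

theorem cosOfSq_comm (u v : ℝ) (x : A) : cosOfSq u v x = cosOfSq v u x := by
  rw [cosOfSq, cosOfSq, add_comm, mul_right_comm]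

theorem map_cosOfSq {B : Type*} [CommRing B] [Algebra ℝ B] (φ : A →ₐ[ℝ] B) (u v : ℝ) (x : A) :
    φ (cosOfSq u v x) = cosOfSq u v (φ x) := by
  rw [cosOfSq, cosOfSq, map_smul, map_sub, AlgHom.commutes]

theorem mul_cosOfSq (hu : 0 < u) (hv : 0 < v) (x : A) :
    algebraMap ℝ A (2 * u * v) * cosOfSq u v x = algebraMap ℝ A (u ^ 2 + v ^ 2) - x := by
  rw [cosOfSq, ← Algebra.smul_def, smul_inv_smul₀ (by positivity)]

theorem mul_cosOfSq_add_sign (hu : 0 < u) (hv : 0 < v) {σ : ℝ} (hσ : σ ^ 2 = 1) (x : A) :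
    algebraMap ℝ A (2 * u * v) * (cosOfSq u v x + algebraMap ℝ A σ) =
      algebraMap ℝ A ((u + σ * v) ^ 2) - x := by
  have hsq : (u + σ * v) ^ 2 = u ^ 2 + v ^ 2 + 2 * u * v * σ := by linear_combination v ^ 2 * hσ
  rw [mul_add, mul_cosOfSq hu hv, hsq, map_add _ (u ^ 2 + v ^ 2),
    map_mul _ (2 * u * v) σ]
  ring

theorem cosOfSq_sq_eq_one_iff (hu : 0 < u) (hv : 0 < v) (ρ : ℝ) :
    cosOfSq u v ρ ^ 2 = 1 ↔ ρ = (u + v) ^ 2 ∨ ρ = (u - v) ^ 2 := by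
  have h : (2 * u * v) ^ 2 * (cosOfSq u v ρ ^ 2 - 1) = (ρ - (u + v) ^ 2) * (ρ - (u - v) ^ 2) := by
    have hcos : 2 * u * v * cosOfSq u v ρ = u ^ 2 + v ^ 2 - ρ := mul_cosOfSq hu hv ρ
    linear_combination (2 * u * v * cosOfSq u v ρ + u ^ 2 + v ^ 2 - ρ) * hcos
  have hne : (2 * u * v) ^ 2 ≠ 0 := by positivity
  rw [← sub_eq_zero, ← mul_right_inj' hne, h, mul_zero, mul_eq_zero, sub_eq_zero, sub_eq_zero]

theorem adjoin_cosOfSq (hu : 0 < u) (hv : 0 < v) (x : L) : ℝ⟮cosOfSq u v x⟯ = ℝ⟮x⟯ := by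
  have hx : x = algebraMap ℝ L (u ^ 2 + v ^ 2) - algebraMap ℝ L (2 * u * v) * cosOfSq u v x := by
    rw [mul_cosOfSq hu hv, sub_sub_cancel]
  refine le_antisymm (adjoin_simple_le_iff.2 ?_) (adjoin_simple_le_iff.2 ?_)
  · exact IntermediateField.smul_mem _ (sub_mem (_root_.algebraMap_mem _ _)
      (mem_adjoin_simple_self ℝ x))
  · have hmem := sub_mem (_root_.algebraMap_mem ℝ⟮cosOfSq u v x⟯ (u ^ 2 + v ^ 2))
      (mul_mem (_root_.algebraMap_mem _ (2 * u * v)) (mem_adjoin_simple_self ℝ (cosOfSq u v x)))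
    rwa [← hx] at hmem

theorem transcendental_cosOfSq (hu : 0 < u) (hv : 0 < v) {x : A} (hx : Transcendental ℝ x) :
    Transcendental ℝ (cosOfSq u v x) := by
  intro hcos
  have hx' : x = algebraMap ℝ A (u ^ 2 + v ^ 2) - algebraMap ℝ A (2 * u * v) * cosOfSq u v x := by
    rw [mul_cosOfSq hu hv, sub_sub_cancel]
  exact hx (hx' ▸ (isAlgebraic_algebraMap _).sub ((isAlgebraic_algebraMap _).mul hcos))

theorem pair_eq_of_cosOfSq_sq_eq_one {w₁ w₂ v₁ v₂ : ℝ} (hw₁ : 0 < w₁) (hw₂ : 0 < w₂)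
    (hv₁ : 0 < v₁) (hv₂ : 0 < v₂)
    (h : ∀ ρ : ℝ, cosOfSq w₁ w₂ ρ ^ 2 = 1 → cosOfSq v₁ v₂ ρ ^ 2 = 1) :
    (w₁ = v₁ ∧ w₂ = v₂) ∨ (w₁ = v₂ ∧ w₂ = v₁) := by
  simp only [cosOfSq_sq_eq_one_iff, hw₁, hw₂, hv₁, hv₂] at h
  have hw := mul_pos hw₁ hw₂
  have hv := mul_pos hv₁ hv₂
  obtain ⟨hadd, hsub⟩ : (w₁ + w₂) ^ 2 = (v₁ + v₂) ^ 2 ∧ (w₁ - w₂) ^ 2 = (v₁ - v₂) ^ 2 := by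
    rcases h _ (.inl rfl) with h₁ | h₁ <;> rcases h _ (.inr rfl) with h₂ | h₂
    · nlinarith
    · exact ⟨h₁, h₂⟩
    · nlinarith
    · nlinarith
  have hadd' : w₁ + w₂ = v₁ + v₂ := (sq_eq_sq₀ (by positivity) (by positivity)).1 hadd
  rcases sq_eq_sq_iff_eq_or_eq_neg.1 hsub with h | h
  · exact .inl ⟨by linarith, by linarith⟩
  · exact .inr ⟨by linarith, by linarith⟩

end CosOfSq

/-- The link of a four-valent vertex with consecutive neighbours `U₁, W₁, U₂, W₂` at distances
`u₁, w₁, u₂, w₂`, with the cosines `α, β, γ, δ` of the four face angles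
`U₁W₁, W₁U₂, U₂W₂, W₂U₁`. -/
structure VertexFigure where
  u₁ : ℝ
  w₁ : ℝ
  u₂ : ℝ
  w₂ : ℝ
  α : ℝ
  β : ℝ
  γ : ℝ
  δ : ℝ
  u₁_pos : 0 < u₁
  w₁_pos : 0 < w₁
  u₂_pos : 0 < u₂
  w₂_pos : 0 < w₂
  α_sq : α ^ 2 < 1
  β_sq : β ^ 2 < 1
  γ_sq : γ ^ 2 < 1
  δ_sq : δ ^ 2 < 1

namespace VertexFigure

/-- The same link with the two pairs of opposite neighbours exchanged. -/
def rotate (V : VertexFigure) : VertexFigure where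
  u₁ := V.w₁
  w₁ := V.u₂
  u₂ := V.w₂
  w₂ := V.u₁
  α := V.β
  β := V.γ
  γ := V.δ
  δ := V.α
  u₁_pos := V.w₁_pos
  w₁_pos := V.u₂_pos
  u₂_pos := V.w₂_pos
  w₂_pos := V.u₁_pos
  α_sq := V.β_sq
  β_sq := V.γ_sq
  γ_sq := V.δ_sq
  δ_sq := V.α_sq

/-- The face angles come in adjacent equal (`κ = 1`) or supplementary (`κ = -1`) pairs, with axis
`W₁W₂`. -/
def Deltoid (V : VertexFigure) (κ : ℝ) : Prop :=
  κ ^ 2 = 1 ∧ V.α = κ * V.β ∧ V.δ = κ * V.γ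

/-- Opposite face angles are equal (`ε = 1`) or supplementary (`ε = -1`). -/
def Isogram (V : VertexFigure) (ε : ℝ) : Prop :=
  ε ^ 2 = 1 ∧ V.α = ε * V.γ ∧ V.β = ε * V.δ

theorem Isogram.rotate {V : VertexFigure} {ε : ℝ} (h : V.Isogram ε) : V.rotate.Isogram ε := by
  obtain ⟨hε, hα, hβ⟩ := h
  refine ⟨hε, hβ, ?_⟩
  simp only [VertexFigure.rotate]
  linear_combination -V.γ * hε - ε * hα

/-- The edges to `W₁` and `W₂` have the same lengths, up to order, at the two vertices. -/
def SameAxis (V V' : VertexFigure) : Prop :=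
  (V.w₁ = V'.w₁ ∧ V.w₂ = V'.w₂) ∨ (V.w₁ = V'.w₂ ∧ V.w₂ = V'.w₁)

variable {L : Type*} [Field L] [Algebra ℝ L] {V V' : VertexFigure} {x z : L}

/-- The squared diagonals `x = |U₁U₂|²` and `z = |W₁W₂|²` satisfy the relation expressing that the
four edges at the vertex lie in a three-dimensional space. -/
def Flexes (V : VertexFigure) (x z : L) : Prop :=
  sphericalGram (algebraMap ℝ L V.α) (algebraMap ℝ L V.β) (algebraMap ℝ L V.γ)
    (algebraMap ℝ L V.δ) (cosOfSq V.u₁ V.u₂ x) (cosOfSq V.w₁ V.w₂ z) = 0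

namespace Flexes

theorem rotate (h : V.Flexes x z) : V.rotate.Flexes z x := by
  simp only [Flexes, VertexFigure.rotate]
  rwa [cosOfSq_comm V.u₂ V.u₁, sphericalGram_rotate]

theorem deltoid_or_isogram (h : V.Flexes x z) (hz : Transcendental ℝ z) (hxz : x ∈ ℝ⟮z⟯) :
    (∃ κ, V.Deltoid κ) ∨ ∃ ε, V.Isogram ε := by
  refine deltoid_or_isogram_of_mem_adjoin V.α_sq V.δ_sq
    (transcendental_cosOfSq V.w₁_pos V.w₂_pos hz) h ?_
  rw [← adjoin_simple_le_iff, adjoin_cosOfSq V.u₁_pos V.u₂_pos, adjoin_cosOfSq V.w₁_pos V.w₂_pos]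
  exact adjoin_simple_le_iff.2 hxz

theorem bilinear_of_isogram (h : V.Flexes x z) (hx : Transcendental ℝ x)
    (hz : Transcendental ℝ z) {ε : ℝ} (hV : V.Isogram ε) :
    ∃ σ k : ℝ, σ ^ 2 = 1 ∧ 0 < ε * k ∧
      (x - algebraMap ℝ L ((V.u₁ + σ * V.u₂) ^ 2)) *
        (z - algebraMap ℝ L ((V.w₁ + σ * ε * V.w₂) ^ 2)) = algebraMap ℝ L k := by
  obtain ⟨hε, hα, hβ⟩ := hV
  have hεL : algebraMap ℝ L ε ^ 2 = 1 := by rw [← map_pow, hε, map_one]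
  obtain ⟨σ, hσ, hrel⟩ : ∃ σ : ℝ, σ ^ 2 = 1 ∧
      (cosOfSq V.u₁ V.u₂ x + algebraMap ℝ L σ) * (cosOfSq V.w₁ V.w₂ z + algebraMap ℝ L (σ * ε)) =
        algebraMap ℝ L (ε * (V.γ + σ * V.δ) ^ 2) := by
    rw [Flexes, hα, hβ, map_mul, map_mul, sphericalGram_isogram hεL] at h
    rcases mul_eq_zero.1 h with h | h
    · exact ⟨1, one_pow 2, by simpa [sub_eq_zero] using h⟩
    · refine ⟨-1, by norm_num, ?_⟩
      simp only [map_mul, map_add, map_pow, map_neg, map_one]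
      linear_combination h
  have hσε : (σ * ε) ^ 2 = 1 := by rw [mul_pow, hσ, hε, one_mul]
  have hxz : (x - algebraMap ℝ L ((V.u₁ + σ * V.u₂) ^ 2)) *
      (z - algebraMap ℝ L ((V.w₁ + σ * ε * V.w₂) ^ 2)) = algebraMap ℝ L
        (2 * V.u₁ * V.u₂ * (2 * V.w₁ * V.w₂) * (ε * (V.γ + σ * V.δ) ^ 2)) := by
    rw [map_mul, ← hrel, map_mul _ (2 * V.u₁ * V.u₂), mul_mul_mul_comm,
      mul_cosOfSq_add_sign V.u₁_pos V.u₂_pos hσ, mul_cosOfSq_add_sign V.w₁_pos V.w₂_pos hσε]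
    ring
  refine ⟨σ, _, hσ, ?_, hxz⟩
  have hne : V.γ + σ * V.δ ≠ 0 := by
    intro h0
    rw [h0, zero_pow two_ne_zero, mul_zero, mul_zero, map_zero] at hxz
    rcases mul_eq_zero.1 hxz with h | h
    · exact ne_algebraMap_of_transcendental hx _ (sub_eq_zero.1 h)
    · exact ne_algebraMap_of_transcendental hz _ (sub_eq_zero.1 h)
  have := V.u₁_pos
  have := V.u₂_pos
  have := V.w₁_pos
  have := V.w₂_pos
  calc 0 < 2 * V.u₁ * V.u₂ * (2 * V.w₁ * V.w₂) * (V.γ + σ * V.δ) ^ 2 := by positivity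
    _ = ε * (2 * V.u₁ * V.u₂ * (2 * V.w₁ * V.w₂) * (ε * (V.γ + σ * V.δ) ^ 2)) := by
      linear_combination -(2 * V.u₁ * V.u₂ * (2 * V.w₁ * V.w₂) * (V.γ + σ * V.δ) ^ 2) * hε

theorem mem_of_isogram (h : V.Flexes x z) (hx : Transcendental ℝ x) (hz : Transcendental ℝ z)
    {ε : ℝ} (hV : V.Isogram ε) : x ∈ ℝ⟮z⟯ := by
  obtain ⟨σ, k, -, -, hxz⟩ := h.bilinear_of_isogram hx hz hV
  have hsub : z - algebraMap ℝ L ((V.w₁ + σ * ε * V.w₂) ^ 2) ∈ ℝ⟮z⟯ :=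
    sub_mem (mem_adjoin_simple_self ℝ z) (_root_.algebraMap_mem _ _)
  refine mem_of_mul_add_eq_zero hsub (neg_mem (add_mem (mul_mem (_root_.algebraMap_mem _
    ((V.u₁ + σ * V.u₂) ^ 2)) hsub) (_root_.algebraMap_mem _ k)))
    (sub_ne_zero.2 (ne_algebraMap_of_transcendental hz _)) ?_
  linear_combination hxz

theorem relation_of_deltoid (h : V.Flexes x z) (hx : Transcendental ℝ x) {κ : ℝ}
    (hV : V.Deltoid κ) :
    (algebraMap ℝ L ((V.u₁ + κ * V.u₂) ^ 2) - x) * (cosOfSq V.w₁ V.w₂ z ^ 2 - 1) =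
      algebraMap ℝ L (2 * V.u₁ * V.u₂ * κ) * (algebraMap ℝ L (4 * V.α * V.δ) *
        cosOfSq V.w₁ V.w₂ z - algebraMap ℝ L (2 * (V.α ^ 2 + V.δ ^ 2))) := by
  obtain ⟨hκ, hα, hδ⟩ := hV
  have hκL : algebraMap ℝ L κ ^ 2 = 1 := by rw [← map_pow, hκ, map_one]
  have hX := transcendental_cosOfSq V.u₁_pos V.u₂_pos hx
  rw [Flexes, hα, hδ, map_mul, map_mul, sphericalGram_deltoid hκL] at h
  have hne : algebraMap ℝ L κ * cosOfSq V.u₁ V.u₂ x - 1 ≠ 0 := fun h0 =>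
    ne_algebraMap_of_transcendental hX κ
      (by linear_combination algebraMap ℝ L κ * h0 - cosOfSq V.u₁ V.u₂ x * hκL)
  have hrel := (mul_eq_zero.1 h).resolve_left hne
  rw [← mul_cosOfSq_add_sign V.u₁_pos V.u₂_pos hκ, hα, hδ]
  simp only [map_mul, map_add, map_pow, map_ofNat]
  linear_combination 2 * algebraMap ℝ L V.u₁ * algebraMap ℝ L V.u₂ * algebraMap ℝ L κ * hrel
    - 2 * algebraMap ℝ L V.u₁ * algebraMap ℝ L V.u₂ *
      (cosOfSq V.u₁ V.u₂ x * (cosOfSq V.w₁ V.w₂ z ^ 2 - 1) + algebraMap ℝ L κ *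
        (4 * algebraMap ℝ L V.β * algebraMap ℝ L V.γ * cosOfSq V.w₁ V.w₂ z
          - 2 * (algebraMap ℝ L V.β ^ 2 + algebraMap ℝ L V.γ ^ 2))) * hκL

theorem mem_of_deltoid (h : V.Flexes x z) (hx : Transcendental ℝ x) (hz : Transcendental ℝ z)
    {κ : ℝ} (hV : V.Deltoid κ) : x ∈ ℝ⟮z⟯ := by
  have hrel := h.relation_of_deltoid hx hV
  have hZ : cosOfSq V.w₁ V.w₂ z ∈ ℝ⟮z⟯ :=
    adjoin_cosOfSq V.w₁_pos V.w₂_pos z ▸ mem_adjoin_simple_self ℝ _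
  have hmap (k : ℝ) : algebraMap ℝ L k ∈ ℝ⟮z⟯ := _root_.algebraMap_mem _ k
  have hsub := sub_mem (pow_mem hZ 2) (one_mem ℝ⟮z⟯)
  refine mem_of_mul_add_eq_zero hsub (sub_mem (mul_mem (hmap (2 * V.u₁ * V.u₂ * κ))
    (sub_mem (mul_mem (hmap (4 * V.α * V.δ)) hZ) (hmap (2 * (V.α ^ 2 + V.δ ^ 2)))))
    (mul_mem (hmap ((V.u₁ + κ * V.u₂) ^ 2)) hsub))
    (sq_sub_one_ne_zero_of_transcendental (transcendental_cosOfSq V.w₁_pos V.w₂_pos hz)) ?_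
  linear_combination -hrel

theorem isogram_of_mem_mem (h : V.Flexes x z) (hx : Transcendental ℝ x) (hz : Transcendental ℝ z)
    (hxz : x ∈ ℝ⟮z⟯) (hzx : z ∈ ℝ⟮x⟯) : ∃ ε, V.Isogram ε := by
  rcases h.deltoid_or_isogram hz hxz with ⟨κ, hκ, hα, hδ⟩ | hV
  · rcases h.rotate.deltoid_or_isogram hx hzx with ⟨κ', hκ', hβ, hα'⟩ | ⟨ε, hV⟩
    · simp only [VertexFigure.rotate] at hβ hα'
      refine ⟨κ * κ', by rw [mul_pow, hκ, hκ', one_mul], by rw [hα, hβ]; ring, ?_⟩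
      rw [hβ, hδ]
      linear_combination -κ' * V.γ * hκ
    · exact ⟨ε, hV.rotate.rotate.rotate⟩
  · exact hV

theorem deltoid_of_mem_notMem (h : V.Flexes x z) (hx : Transcendental ℝ x)
    (hz : Transcendental ℝ z) (hxz : x ∈ ℝ⟮z⟯) (hzx : z ∉ ℝ⟮x⟯) : ∃ κ, V.Deltoid κ :=
  (h.deltoid_or_isogram hz hxz).resolve_right
    fun ⟨_, hV⟩ => hzx (h.rotate.mem_of_isogram hz hx hV.rotate)

end Flexes

end VertexFigure

theorem aeval_cosOfSq_X {A : Type*} [CommRing A] [Algebra ℝ A] (u v : ℝ) (x : A) :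
    aeval x (cosOfSq u v (X : ℝ[X])) = cosOfSq u v x := by
  rw [map_cosOfSq, aeval_X]

theorem eval_cosOfSq_X (u v ρ : ℝ) : (cosOfSq u v (X : ℝ[X])).eval ρ = cosOfSq u v ρ := by
  rw [← coe_aeval_eq_eval, aeval_cosOfSq_X]

theorem exists_cosOfSq_eq_add_mul {A : Type*} [CommRing A] [Algebra ℝ A] {u v u' v' : ℝ}
    (hu : 0 < u) (hv : 0 < v) (hu' : 0 < u') (hv' : 0 < v') (x : A) :
    ∃ a b : ℝ, b ≠ 0 ∧ cosOfSq u' v' x = algebraMap ℝ A a + algebraMap ℝ A b * cosOfSq u v x := by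
  refine ⟨(2 * u' * v')⁻¹ * (u' ^ 2 + v' ^ 2 - (u ^ 2 + v ^ 2)), (2 * u' * v')⁻¹ * (2 * u * v),
    by positivity, ?_⟩
  rw [map_mul _ _ (2 * u * v), mul_assoc (algebraMap ℝ A _), mul_cosOfSq hu hv, cosOfSq,
    Algebra.smul_def, map_mul, map_sub]
  ring

namespace VertexFigure

variable {L : Type*} [Field L] [Algebra ℝ L] {V V' : VertexFigure} {x z : L}

theorem exists_quadratic (V : VertexFigure) : ∃ p₁ p₀ : ℝ[X],
    (∀ X ρ : ℝ, sphericalGram V.α V.β V.γ V.δ X (cosOfSq V.w₁ V.w₂ ρ) =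
      (cosOfSq V.w₁ V.w₂ ρ ^ 2 - 1) * X ^ 2 + p₁.eval ρ * X + p₀.eval ρ) ∧
    ∀ {L : Type*} [Field L] [Algebra ℝ L] {x z : L}, V.Flexes x z →
      aeval z (cosOfSq V.w₁ V.w₂ (X : ℝ[X]) ^ 2 - 1) * cosOfSq V.u₁ V.u₂ x ^ 2
        + aeval z p₁ * cosOfSq V.u₁ V.u₂ x + aeval z p₀ = 0 := by
  obtain ⟨u₁, w₁, u₂, w₂, α, β, γ, δ⟩ := V
  refine ⟨2 * (C (α * β + γ * δ) - C (α * γ + β * δ) * cosOfSq w₁ w₂ X),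
    2 * C (α * δ + β * γ) * cosOfSq w₁ w₂ X - cosOfSq w₁ w₂ X ^ 2
      + C (1 - α ^ 2 - β ^ 2 - γ ^ 2 - δ ^ 2 + (α * γ - β * δ) ^ 2),
    fun X ρ => ?_, fun {L} _ _ x z h => ?_⟩
  · simp only [sphericalGram_eq, eval_add, eval_sub, eval_mul, eval_pow, eval_ofNat, eval_C,
      eval_cosOfSq_X]
    ring
  · rw [Flexes, sphericalGram_eq] at h
    simp only [map_add, map_sub, map_mul, map_pow, map_one, map_ofNat, aeval_C, aeval_cosOfSq_X]
    linear_combination h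

namespace Flexes

theorem sphericalGram_eq_zero_of_notMem (h : V.Flexes x z) (h' : V'.Flexes x z)
    (hz : Transcendental ℝ z) (hxz : x ∉ ℝ⟮z⟯) {ρ : ℝ} (hρ : cosOfSq V.w₁ V.w₂ ρ ^ 2 = 1)
    (hρ' : cosOfSq V'.w₁ V'.w₂ ρ ^ 2 ≠ 1) (X : ℝ) :
    sphericalGram V.α V.β V.γ V.δ X (cosOfSq V.w₁ V.w₂ ρ) = 0 := by
  obtain ⟨p₁, p₀, hgram, hp⟩ := V.exists_quadratic
  obtain ⟨q₁, q₀, -, hq⟩ := V'.exists_quadratic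
  obtain ⟨a, b, hb, hab⟩ := exists_cosOfSq_eq_add_mul V.u₁_pos V.u₂_pos V'.u₁_pos V'.u₂_pos x
  set q₂ : ℝ[X] := cosOfSq V'.w₁ V'.w₂ Polynomial.X ^ 2 - 1 with hq₂
  have hx : cosOfSq V.u₁ V.u₂ x ∉ ℝ⟮z⟯ := by
    rwa [← adjoin_simple_le_iff, adjoin_cosOfSq V.u₁_pos V.u₂_pos, adjoin_simple_le_iff]
  have hq' : aeval z (C (b ^ 2) * q₂) * cosOfSq V.u₁ V.u₂ x ^ 2
      + aeval z (C (2 * a * b) * q₂ + C b * q₁) * cosOfSq V.u₁ V.u₂ x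
      + aeval z (C (a ^ 2) * q₂ + C a * q₁ + q₀) = 0 := by
    have hq := hq h'
    rw [hab] at hq
    simp only [map_add, map_mul, map_pow, map_ofNat, aeval_C]
    linear_combination hq
  obtain ⟨h₁, h₀⟩ := isRoot_of_quadratic_of_quadratic hz hx (hp h) hq' (ρ := ρ)
    (by simp [IsRoot, eval_cosOfSq_X, hρ])
    (by simp [hq₂, IsRoot, eval_cosOfSq_X, hb, sub_eq_zero, hρ'])
  rw [hgram, hρ, h₁.eq_zero, h₀.eq_zero, sub_self, zero_mul, zero_mul, add_zero, add_zero]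

theorem sameAxis_of_notMem_notMem (h : V.Flexes x z) (h' : V'.Flexes x z)
    (hx : Transcendental ℝ x) (hz : Transcendental ℝ z) (hxz : x ∉ ℝ⟮z⟯) (hzx : z ∉ ℝ⟮x⟯) :
    V.SameAxis V' := by
  refine pair_eq_of_cosOfSq_sq_eq_one V.w₁_pos V.w₂_pos V'.w₁_pos V'.w₂_pos
    fun ρ hρ => by_contra fun hρ' => hzx ?_
  obtain ⟨hα, hβ⟩ := eq_mul_of_sphericalGram_eq_zero hρ V.γ_sq V.δ_sq
    (h.sphericalGram_eq_zero_of_notMem h' hz hxz hρ hρ')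
  exact h.rotate.mem_of_deltoid hz hx ⟨hρ, hβ, hα⟩

theorem exists_linear_of_deltoid (h : V.Flexes x z) (hx : Transcendental ℝ x) {κ : ℝ}
    (hV : V.Deltoid κ) : ∃ p₀ : ℝ[X],
      (∀ ρ : ℝ, cosOfSq V.w₁ V.w₂ ρ ^ 2 = 1 → p₀.eval ρ =
        -(4 * V.u₁ * V.u₂ * κ) * (V.α - cosOfSq V.w₁ V.w₂ ρ * V.δ) ^ 2) ∧
      aeval z (cosOfSq V.w₁ V.w₂ (X : ℝ[X]) ^ 2 - 1) * x + aeval z p₀ = 0 := by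
  have hrel := h.relation_of_deltoid hx hV
  refine ⟨C (2 * V.u₁ * V.u₂ * κ) * (C (4 * V.α * V.δ) * cosOfSq V.w₁ V.w₂ X
      - C (2 * (V.α ^ 2 + V.δ ^ 2)))
    - C ((V.u₁ + κ * V.u₂) ^ 2) * (cosOfSq V.w₁ V.w₂ X ^ 2 - 1), fun ρ hρ => ?_, ?_⟩
  · simp only [eval_sub, eval_mul, eval_pow, eval_one, eval_C, eval_cosOfSq_X]
    linear_combination (4 * V.u₁ * V.u₂ * κ * V.δ ^ 2 - (V.u₁ + κ * V.u₂) ^ 2) * hρ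
  · simp only [map_sub, map_add, map_mul, map_pow, map_one, aeval_C, aeval_cosOfSq_X] at hrel ⊢
    linear_combination -hrel

theorem sameAxis_of_mem_notMem (h : V.Flexes x z) (h' : V'.Flexes x z)
    (hx : Transcendental ℝ x) (hz : Transcendental ℝ z) (hxz : x ∈ ℝ⟮z⟯) (hzx : z ∉ ℝ⟮x⟯) :
    V.SameAxis V' := by
  obtain ⟨κ, hV⟩ := h.deltoid_of_mem_notMem hx hz hxz hzx
  obtain ⟨κ', hV'⟩ := h'.deltoid_of_mem_notMem hx hz hxz hzx
  obtain ⟨p₀, hp₀, hp⟩ := h.exists_linear_of_deltoid hx hV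
  obtain ⟨q₀, -, hq⟩ := h'.exists_linear_of_deltoid hx hV'
  obtain ⟨hκ, hα, hδ⟩ := hV
  refine pair_eq_of_cosOfSq_sq_eq_one V.w₁_pos V.w₂_pos V'.w₁_pos V'.w₂_pos
    fun ρ hρ => by_contra fun hρ' => hzx ?_
  have hroot := (isRoot_of_linear_of_linear hz hp hq (ρ := ρ)
    (by simp [IsRoot, eval_cosOfSq_X, hρ])
    (by simp [IsRoot, eval_cosOfSq_X, sub_eq_zero, hρ'])).eq_zero
  have hne : -(4 * V.u₁ * V.u₂ * κ) ≠ 0 := by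
    have := V.u₁_pos
    have := V.u₂_pos
    have : κ ≠ 0 := by
      rintro rfl
      norm_num at hκ
    exact neg_ne_zero.2 (by positivity)
  rw [hp₀ ρ hρ, mul_eq_zero, or_iff_right hne, sq_eq_zero_iff, sub_eq_zero] at hroot
  have hV : V.Isogram (cosOfSq V.w₁ V.w₂ ρ * κ) := by
    refine ⟨by rw [mul_pow, hρ, hκ, one_mul], by rw [hroot, hδ, mul_assoc], ?_⟩
    linear_combination κ * hroot - κ * hα - V.β * hκ
  exact h.rotate.mem_of_isogram hz hx hV.rotate

theorem sq_add_eq_of_deltoid (h : V.Flexes x z) (h' : V'.Flexes x z) (hx : Transcendental ℝ x)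
    (hz : Transcendental ℝ z) (hw : V.SameAxis V') {κ κ' : ℝ} (hV : V.Deltoid κ)
    (hV' : V'.Deltoid κ') : (V.u₁ + κ * V.u₂) ^ 2 = (V'.u₁ + κ' * V'.u₂) ^ 2 := by
  have hrel := h.relation_of_deltoid hx hV
  have hrel' := h'.relation_of_deltoid hx hV'
  have hcos : cosOfSq V'.w₁ V'.w₂ z = cosOfSq V.w₁ V.w₂ z := by
    rcases hw with ⟨h₁, h₂⟩ | ⟨h₁, h₂⟩
    · rw [h₁, h₂]
    · rw [h₁, h₂, cosOfSq_comm]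
  rw [hcos] at hrel'
  refine sub_eq_zero.1 (coeff_eq_zero_of_quadratic_eq_zero
    (transcendental_cosOfSq V.w₁_pos V.w₂_pos hz)
    (b := 2 * V'.u₁ * V'.u₂ * κ' * (4 * V'.α * V'.δ) - 2 * V.u₁ * V.u₂ * κ * (4 * V.α * V.δ))
    (c := (V'.u₁ + κ' * V'.u₂) ^ 2 - (V.u₁ + κ * V.u₂) ^ 2
      + 2 * V.u₁ * V.u₂ * κ * (2 * (V.α ^ 2 + V.δ ^ 2))
      - 2 * V'.u₁ * V'.u₂ * κ' * (2 * (V'.α ^ 2 + V'.δ ^ 2))) ?_).1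
  simp only [map_sub, map_mul, map_add, map_pow] at hrel hrel' ⊢
  linear_combination hrel - hrel'

end Flexes

/-- Two vertices see the same pair of diagonals `x`, `z`, all their opposite face angles are equal
(`σ * τ = 1`) or supplementary (`σ * τ = -1`), and `x` and `z` determine each other through a
bilinear relation. The poles of this relation are read off the edges at either vertex. -/
structure IsogramPair (V V' : VertexFigure) (x z : L) (σ τ k : ℝ) : Prop where
  σ_sq : σ ^ 2 = 1
  τ_sq : τ ^ 2 = 1
  pos : 0 < σ * τ * k
  isogram : V.Isogram (σ * τ)
  isogram' : V'.Isogram (σ * τ)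
  pole_x : ∃ σ' : ℝ, σ' ^ 2 = 1 ∧ (V.u₁ + σ * V.u₂) ^ 2 = (V'.u₁ + σ' * V'.u₂) ^ 2
  pole_z : ∃ τ' : ℝ, τ' ^ 2 = 1 ∧ (V.w₁ + τ * V.w₂) ^ 2 = (V'.w₁ + τ' * V'.w₂) ^ 2
  bilinear : (x - algebraMap ℝ L ((V.u₁ + σ * V.u₂) ^ 2)) *
    (z - algebraMap ℝ L ((V.w₁ + τ * V.w₂) ^ 2)) = algebraMap ℝ L k

theorem Flexes.exists_isogramPair (h : V.Flexes x z) (h' : V'.Flexes x z)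
    (hx : Transcendental ℝ x) (hz : Transcendental ℝ z) (hxz : x ∈ ℝ⟮z⟯) (hzx : z ∈ ℝ⟮x⟯) :
    ∃ σ τ k : ℝ, V.IsogramPair V' x z σ τ k := by
  obtain ⟨ε, hV⟩ := h.isogram_of_mem_mem hx hz hxz hzx
  obtain ⟨ε', hV'⟩ := h'.isogram_of_mem_mem hx hz hxz hzx
  obtain ⟨σ, k, hσ, hk, hrel⟩ := h.bilinear_of_isogram hx hz hV
  obtain ⟨σ', k', hσ', hk', hrel'⟩ := h'.bilinear_of_isogram hx hz hV'
  obtain ⟨hu, hw, rfl⟩ := bilinear_relation_unique hz (by rintro rfl; simp at hk) hrel hrel'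
  have hε : ε = ε' := by
    rcases sq_eq_sq_iff_eq_or_eq_neg.1 (hV.1.trans hV'.1.symm) with h | h
    · exact h
    · rw [h] at hk
      linarith
  subst hε
  have hσε : σ * (σ * ε) = ε := by linear_combination ε * hσ
  refine ⟨σ, σ * ε, k, hσ, ?_, by rwa [hσε], by rwa [hσε], by rwa [hσε], ⟨σ', hσ', hu⟩,
    ⟨σ' * ε, ?_, hw⟩, hrel⟩
  · rw [mul_pow, hσ, hV.1, one_mul]
  · rw [mul_pow, hσ', hV.1, one_mul]

end VertexFigure

section Geometry

variable {E : Type*} [NormedAddCommGroup E] [InnerProductSpace ℝ E]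

theorem sphericalGram_inner_eq_zero [FiniteDimensional ℝ E] (hE : Module.finrank ℝ E ≤ 3)
    {v : Fin 4 → E} (hv : ∀ i, ‖v i‖ = 1) :
    sphericalGram (inner ℝ (v 0) (v 1)) (inner ℝ (v 1) (v 2)) (inner ℝ (v 2) (v 3))
      (inner ℝ (v 3) (v 0)) (inner ℝ (v 0) (v 2)) (inner ℝ (v 1) (v 3)) = 0 := by
  have hself (i : Fin 4) : inner ℝ (v i) (v i) = 1 := by
    rw [real_inner_self_eq_norm_sq, hv, one_pow]
  have hgram : Matrix.gram ℝ v =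
      !![1, inner ℝ (v 0) (v 1), inner ℝ (v 0) (v 2), inner ℝ (v 3) (v 0);
      inner ℝ (v 0) (v 1), 1, inner ℝ (v 1) (v 2), inner ℝ (v 1) (v 3);
      inner ℝ (v 0) (v 2), inner ℝ (v 1) (v 2), 1, inner ℝ (v 2) (v 3);
      inner ℝ (v 3) (v 0), inner ℝ (v 1) (v 3), inner ℝ (v 2) (v 3), 1] := by
    ext i j
    fin_cases i <;> fin_cases j <;>
      first | exact hself _ | exact real_inner_comm _ _ | rfl
  rw [sphericalGram, ← hgram]
  by_contra hdet
  have hcard := (Matrix.linearIndependent_of_det_gram_ne_zero hdet).fintype_card_le_finrank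
  rw [Fintype.card_fin] at hcard
  omega

theorem inner_inv_smul_sub_eq_cosOfSq {O A B : E} {u v : ℝ} (hA : dist O A = u)
    (hB : dist O B = v) :
    inner ℝ (u⁻¹ • (A - O)) (v⁻¹ • (B - O)) = cosOfSq u v (dist A B ^ 2) := by
  rw [real_inner_smul_left, real_inner_smul_right,
    real_inner_eq_norm_mul_self_add_norm_mul_self_sub_norm_sub_mul_self_div_two,
    sub_sub_sub_cancel_right, ← dist_eq_norm, ← dist_eq_norm, ← dist_eq_norm, dist_comm A O,
    dist_comm B O, hA, hB, cosOfSq, smul_eq_mul, Algebra.algebraMap_self_apply]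
  ring

theorem sphericalGram_cosOfSq_dist_eq_zero [FiniteDimensional ℝ E]
    (hE : Module.finrank ℝ E ≤ 3) {O U₁ W₁ U₂ W₂ : E} {u₁ w₁ u₂ w₂ : ℝ} (hu₁ : dist O U₁ = u₁)
    (hw₁ : dist O W₁ = w₁) (hu₂ : dist O U₂ = u₂) (hw₂ : dist O W₂ = w₂) (u₁_pos : 0 < u₁)
    (w₁_pos : 0 < w₁) (u₂_pos : 0 < u₂) (w₂_pos : 0 < w₂) :
    sphericalGram (cosOfSq u₁ w₁ (dist U₁ W₁ ^ 2)) (cosOfSq w₁ u₂ (dist W₁ U₂ ^ 2))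
      (cosOfSq u₂ w₂ (dist U₂ W₂ ^ 2)) (cosOfSq w₂ u₁ (dist W₂ U₁ ^ 2))
      (cosOfSq u₁ u₂ (dist U₁ U₂ ^ 2)) (cosOfSq w₁ w₂ (dist W₁ W₂ ^ 2)) = 0 := by
  have norm_eq_one {u : ℝ} {U : E} (h : dist O U = u) (hu : 0 < u) : ‖u⁻¹ • (U - O)‖ = 1 := by
    rw [norm_smul, ← dist_eq_norm, dist_comm, h, norm_inv, Real.norm_of_nonneg hu.le,
      inv_mul_cancel₀ hu.ne']
  rw [← inner_inv_smul_sub_eq_cosOfSq hu₁ hw₁, ← inner_inv_smul_sub_eq_cosOfSq hw₁ hu₂,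
    ← inner_inv_smul_sub_eq_cosOfSq hu₂ hw₂, ← inner_inv_smul_sub_eq_cosOfSq hw₂ hu₁,
    ← inner_inv_smul_sub_eq_cosOfSq hu₁ hu₂, ← inner_inv_smul_sub_eq_cosOfSq hw₁ hw₂]
  refine sphericalGram_inner_eq_zero hE
    (v := ![u₁⁻¹ • (U₁ - O), w₁⁻¹ • (W₁ - O), u₂⁻¹ • (U₂ - O), w₂⁻¹ • (W₂ - O)]) ?_
  simp only [Fin.forall_fin_succ, IsEmpty.forall_iff, and_true]
  exact ⟨norm_eq_one hu₁ u₁_pos, norm_eq_one hw₁ w₁_pos, norm_eq_one hu₂ u₂_pos,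
    norm_eq_one hw₂ w₂_pos⟩

end Geometry

/-- The strict triangle inequalities. -/
def IsTriangle (a b c : ℝ) : Prop := a < b + c ∧ b < a + c ∧ c < a + b

namespace IsTriangle

variable {a b c : ℝ}

theorem pos_left (h : IsTriangle a b c) : 0 < a := by linarith [h.2.1, h.2.2]

theorem swap (h : IsTriangle a b c) : IsTriangle b a c := ⟨h.2.1, h.1, by linarith [h.2.2]⟩

theorem rot (h : IsTriangle a b c) : IsTriangle b c a :=
  ⟨by linarith [h.2.1], by linarith [h.2.2], by linarith [h.1]⟩

theorem cosOfSq_sq_lt_one (h : IsTriangle a b c) : cosOfSq a b (c ^ 2) ^ 2 < 1 := by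
  have ha := h.pos_left
  have hb := h.swap.pos_left
  have hc := h.rot.rot.pos_left
  have hcos : 2 * a * b * cosOfSq a b (c ^ 2) = a ^ 2 + b ^ 2 - c ^ 2 := mul_cosOfSq ha hb _
  have heron : 0 < (b + c - a) * (a + c - b) * ((a + b - c) * (a + b + c)) :=
    mul_pos (mul_pos (sub_pos.2 h.1) (sub_pos.2 h.2.1)) (mul_pos (sub_pos.2 h.2.2) (by positivity))
  refine lt_of_mul_lt_mul_left ?_ (sq_nonneg (2 * a * b))
  rw [← mul_pow, hcos]
  linarith

end IsTriangle

namespace VertexFigure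

variable {u₁ w₁ u₂ w₂ l₁ l₂ l₃ l₄ : ℝ}

/-- The link of a vertex in terms of the lengths of the edges at the vertex and of the edges
`l₁ = U₁W₁`, `l₂ = W₁U₂`, `l₃ = U₂W₂`, `l₄ = W₂U₁` opposite to it. -/
noncomputable def ofLengths (t₁ : IsTriangle u₁ w₁ l₁) (t₂ : IsTriangle w₁ u₂ l₂)
    (t₃ : IsTriangle u₂ w₂ l₃) (t₄ : IsTriangle w₂ u₁ l₄) : VertexFigure where
  u₁ := u₁
  w₁ := w₁
  u₂ := u₂
  w₂ := w₂
  α := cosOfSq u₁ w₁ (l₁ ^ 2)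
  β := cosOfSq w₁ u₂ (l₂ ^ 2)
  γ := cosOfSq u₂ w₂ (l₃ ^ 2)
  δ := cosOfSq w₂ u₁ (l₄ ^ 2)
  u₁_pos := t₁.pos_left
  w₁_pos := t₂.pos_left
  u₂_pos := t₃.pos_left
  w₂_pos := t₄.pos_left
  α_sq := t₁.cosOfSq_sq_lt_one
  β_sq := t₂.cosOfSq_sq_lt_one
  γ_sq := t₃.cosOfSq_sq_lt_one
  δ_sq := t₄.cosOfSq_sq_lt_one

variable {t₁ : IsTriangle u₁ w₁ l₁} {t₂ : IsTriangle w₁ u₂ l₂} {t₃ : IsTriangle u₂ w₂ l₃}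
  {t₄ : IsTriangle w₂ u₁ l₄} {L : Type*} [Field L] [Algebra ℝ L]

theorem Flexes.reverse {x z : L} (h : (ofLengths t₁ t₂ t₃ t₄).Flexes x z) :
    (ofLengths t₁.swap t₄.swap t₃.swap t₂.swap).Flexes z x := by
  simp only [Flexes, ofLengths, sphericalGram_eq] at h ⊢
  rw [cosOfSq_comm w₁ u₁, cosOfSq_comm u₁ w₂, cosOfSq_comm w₂ u₂, cosOfSq_comm u₂ w₁]
  linear_combination h

theorem Flexes.of_dist {T : Type*} (φ : (T → ℝ) →ₐ[ℝ] L) {E : Type*} [NormedAddCommGroup E]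
    [InnerProductSpace ℝ E] [FiniteDimensional ℝ E] (hE : Module.finrank ℝ E ≤ 3)
    {O U₁ W₁ U₂ W₂ : T → E}
    (hu₁ : ∀ t, dist (O t) (U₁ t) = u₁) (hw₁ : ∀ t, dist (O t) (W₁ t) = w₁)
    (hu₂ : ∀ t, dist (O t) (U₂ t) = u₂) (hw₂ : ∀ t, dist (O t) (W₂ t) = w₂)
    (hl₁ : ∀ t, dist (U₁ t) (W₁ t) = l₁) (hl₂ : ∀ t, dist (W₁ t) (U₂ t) = l₂)
    (hl₃ : ∀ t, dist (U₂ t) (W₂ t) = l₃) (hl₄ : ∀ t, dist (W₂ t) (U₁ t) = l₄) :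
    (ofLengths t₁ t₂ t₃ t₄).Flexes (φ fun t => dist (U₁ t) (U₂ t) ^ 2)
      (φ fun t => dist (W₁ t) (W₂ t) ^ 2) := by
  have hgram : sphericalGram (algebraMap ℝ (T → ℝ) (cosOfSq u₁ w₁ (l₁ ^ 2)))
      (algebraMap ℝ (T → ℝ) (cosOfSq w₁ u₂ (l₂ ^ 2)))
      (algebraMap ℝ (T → ℝ) (cosOfSq u₂ w₂ (l₃ ^ 2)))
      (algebraMap ℝ (T → ℝ) (cosOfSq w₂ u₁ (l₄ ^ 2)))
      (cosOfSq u₁ u₂ fun t => dist (U₁ t) (U₂ t) ^ 2)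
      (cosOfSq w₁ w₂ fun t => dist (W₁ t) (W₂ t) ^ 2) = 0 := by
    funext t
    have h := sphericalGram_cosOfSq_dist_eq_zero hE (hu₁ t) (hw₁ t) (hu₂ t) (hw₂ t) t₁.pos_left
      t₂.pos_left t₃.pos_left t₄.pos_left
    rw [hl₁, hl₂, hl₃, hl₄] at h
    rw [sphericalGram_eq] at h ⊢
    exact h
  have h := congrArg (φ : (T → ℝ) →+* L) hgram
  rw [map_sphericalGram, map_zero] at h
  simp only [RingHom.coe_coe, AlgHom.commutes, map_cosOfSq] at h
  exact h

end VertexFigure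

/-- Each of four lengths is smaller than the sum of the other three. -/
def IsQuadrilateral (w x y z : ℝ) : Prop :=
  w < x + y + z ∧ x < w + y + z ∧ y < w + x + z ∧ z < w + x + y

theorem IsQuadrilateral.rotate {w x y z : ℝ} (h : IsQuadrilateral w x y z) :
    IsQuadrilateral x y z w := by
  obtain ⟨hw, hx, hy, hz⟩ := h
  refine ⟨?_, ?_, ?_, ?_⟩ <;> linarith

theorem IsQuadrilateral.reverse {w x y z : ℝ} (h : IsQuadrilateral w x y z) :
    IsQuadrilateral z y x w := by
  obtain ⟨hw, hx, hy, hz⟩ := h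
  refine ⟨?_, ?_, ?_, ?_⟩ <;> linarith

theorem isQuadrilateral_of_forall_exists_dist_ne {T E : Type*} [PseudoMetricSpace E]
    {A B C D : T → E} {w x y z : ℝ} (hw : ∀ t, dist (A t) (B t) = w)
    (hx : ∀ t, dist (B t) (C t) = x) (hy : ∀ t, dist (C t) (D t) = y)
    (hz : ∀ t, dist (D t) (A t) = z) (h : ∀ k, ∃ t, dist (A t) (C t) ≠ k) :
    IsQuadrilateral w x y z := by
  have hAC (t : T) : dist (A t) (C t) ≤ w + x :=
    hw t ▸ hx t ▸ dist_triangle _ _ _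
  have hCA (t : T) : dist (A t) (C t) ≤ y + z :=
    hy t ▸ hz t ▸ dist_comm (A t) (C t) ▸ dist_triangle _ _ _
  have hABC (t : T) : w - x ≤ dist (A t) (C t) ∧ x - w ≤ dist (A t) (C t) := by
    constructor <;> rw [← hw t, ← hx t]
    · linarith [dist_triangle_right (A t) (B t) (C t)]
    · linarith [dist_triangle_left (B t) (C t) (A t)]
  have hCDA (t : T) : y - z ≤ dist (A t) (C t) ∧ z - y ≤ dist (A t) (C t) := by
    constructor <;> rw [← hy t, ← hz t]
    · linarith [dist_triangle_left (C t) (D t) (A t), dist_comm (A t) (D t)]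
    · linarith [dist_triangle_right (D t) (A t) (C t), dist_comm (C t) (D t)]
  obtain ⟨t, ht⟩ := h (w + x)
  obtain ⟨t', ht'⟩ := h (y + z)
  have hlt := (hAC t).lt_of_ne ht
  have hlt' := (hCA t').lt_of_ne ht'
  exact ⟨by linarith [(hABC t').1], by linarith [(hABC t').2], by linarith [(hCDA t).1],
    by linarith [(hCDA t).2]⟩

namespace OctahedronMetric

variable (K : OctahedronMetric)

theorem triangle_pqc : IsTriangle K.p K.q K.c := K.face_pqc
theorem triangle_qrf : IsTriangle K.q K.r K.f := K.face_qrf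
theorem triangle_rsh : IsTriangle K.r K.s K.h := K.face_rsh
theorem triangle_spg : IsTriangle K.s K.p K.g := K.face_spg
theorem triangle_bac : IsTriangle K.b K.a K.c := K.face_bac
theorem triangle_aef : IsTriangle K.a K.e K.f := K.face_aef
theorem triangle_edh : IsTriangle K.e K.d K.h := K.face_edh
theorem triangle_dbg : IsTriangle K.d K.b K.g := K.face_dbg

/-- The link of `v₁`, with neighbours `v₂, v₃, v₄, v₅`. -/
noncomputable def link₁ : VertexFigure :=
  VertexFigure.ofLengths K.triangle_pqc K.triangle_qrf K.triangle_rsh K.triangle_spg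

/-- The link of `v₆`, with neighbours `v₂, v₃, v₄, v₅`. -/
noncomputable def link₆ : VertexFigure :=
  VertexFigure.ofLengths K.triangle_bac K.triangle_aef K.triangle_edh K.triangle_dbg

/-- The link of `v₃`, with neighbours `v₂, v₁, v₄, v₆`. -/
noncomputable def link₃ : VertexFigure :=
  VertexFigure.ofLengths K.triangle_pqc.rot.swap K.triangle_qrf.rot.rot.swap
    K.triangle_aef.rot.rot K.triangle_bac.rot

/-- The link of `v₅`, with neighbours `v₂, v₁, v₄, v₆`. -/
noncomputable def link₅ : VertexFigure :=
  VertexFigure.ofLengths K.triangle_spg.rot.rot K.triangle_rsh.rot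
    K.triangle_edh.rot.swap K.triangle_dbg.rot.rot.swap

/-- The link of `v₂`, with neighbours `v₃, v₁, v₅, v₆`. -/
noncomputable def link₂ : VertexFigure :=
  VertexFigure.ofLengths K.triangle_pqc.rot.rot K.triangle_spg.rot
    K.triangle_dbg.rot.swap K.triangle_bac.rot.rot.swap

/-- The link of `v₄`, with neighbours `v₃, v₁, v₅, v₆`. -/
noncomputable def link₄ : VertexFigure :=
  VertexFigure.ofLengths K.triangle_qrf.rot.swap K.triangle_rsh.rot.rot.swap
    K.triangle_edh.rot.rot K.triangle_aef.rot

/-- The algebraic content of a nontrivial flex: `x`, `y`, `z` are the squares of the diagonals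
`v₂v₄`, `v₃v₅`, `v₁v₆`, regarded as elements of a field of functions on the parameter interval. -/
structure GenericFlex (K : OctahedronMetric) {L : Type*} [Field L] [Algebra ℝ L] (x y z : L) :
    Prop where
  trans_x : Transcendental ℝ x
  trans_y : Transcendental ℝ y
  trans_z : Transcendental ℝ z
  flex₁ : K.link₁.Flexes x y
  flex₆ : K.link₆.Flexes x y
  flex₃ : K.link₃.Flexes x z
  flex₅ : K.link₅.Flexes x z
  flex₂ : K.link₂.Flexes y z
  flex₄ : K.link₄.Flexes y z
  quad_x : IsQuadrilateral K.s K.q K.a K.d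
  quad_y : IsQuadrilateral K.b K.p K.r K.e
  quad_z : IsQuadrilateral K.c K.f K.h K.g

variable {K}

namespace IsRealization

variable {T L : Type*} [Field L] [Algebra ℝ L] {P : T → Fin 6 → EuclideanSpace ℝ (Fin 3)}

theorem isQuadrilateral (hP : ∀ t, K.IsRealization (P t))
    (hx : ∀ k, ∃ t, dist (P t 1) (P t 3) ≠ k) (hy : ∀ k, ∃ t, dist (P t 2) (P t 4) ≠ k)
    (hz : ∀ k, ∃ t, dist (P t 0) (P t 5) ≠ k) :
    IsQuadrilateral K.s K.q K.a K.d ∧ IsQuadrilateral K.b K.p K.r K.e ∧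
      IsQuadrilateral K.c K.f K.h K.g := by
  simp only [IsRealization, forall_and] at hP
  obtain ⟨hp, hq, hr, hs, hc, hf, hh, hg, hb, ha, he, hd⟩ := hP
  have symm {i j : Fin 6} {l : ℝ} (hl : ∀ t, dist (P t i) (P t j) = l) (t : T) :
      dist (P t j) (P t i) = l := (dist_comm _ _).trans (hl t)
  exact ⟨(isQuadrilateral_of_forall_exists_dist_ne (symm ha) hd (symm hs) hq hy).rotate.rotate,
    (isQuadrilateral_of_forall_exists_dist_ne hr (symm he) hb (symm hp) hz).rotate.rotate,
    isQuadrilateral_of_forall_exists_dist_ne hc hf hh hg hx⟩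

theorem genericFlex (hP : ∀ t, K.IsRealization (P t)) (φ : (T → ℝ) →ₐ[ℝ] L)
    (hx : Transcendental ℝ (φ fun t => dist (P t 1) (P t 3)))
    (hy : Transcendental ℝ (φ fun t => dist (P t 2) (P t 4)))
    (hz : Transcendental ℝ (φ fun t => dist (P t 0) (P t 5))) :
    K.GenericFlex (φ fun t => dist (P t 1) (P t 3) ^ 2) (φ fun t => dist (P t 2) (P t 4) ^ 2)
      (φ fun t => dist (P t 0) (P t 5) ^ 2) := by
  have trans_sq {ξ : T → ℝ} (hξ : Transcendental ℝ (φ ξ)) :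
      Transcendental ℝ (φ fun t => ξ t ^ 2) :=
    (map_pow φ ξ 2).symm ▸ hξ.pow two_pos
  have exists_ne {ξ : T → ℝ} (hξ : Transcendental ℝ (φ ξ)) (k : ℝ) : ∃ t, ξ t ≠ k := by
    contrapose! hξ
    obtain rfl : ξ = algebraMap ℝ (T → ℝ) k := funext hξ
    exact φ.commutes k ▸ fun h => h (isAlgebraic_algebraMap k)
  obtain ⟨quad_x, quad_y, quad_z⟩ :=
    IsRealization.isQuadrilateral hP (exists_ne hx) (exists_ne hy) (exists_ne hz)
  simp only [IsRealization, forall_and] at hP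
  obtain ⟨hp, hq, hr, hs, hc, hf, hh, hg, hb, ha, he, hd⟩ := hP
  have symm {i j : Fin 6} {l : ℝ} (hl : ∀ t, dist (P t i) (P t j) = l) (t : T) :
      dist (P t j) (P t i) = l := (dist_comm _ _).trans (hl t)
  have hE : Module.finrank ℝ (EuclideanSpace ℝ (Fin 3)) ≤ 3 := finrank_euclideanSpace_fin.le
  exact
    { trans_x := trans_sq hx
      trans_y := trans_sq hy
      trans_z := trans_sq hz
      flex₁ := .of_dist φ hE hp hq hr hs hc hf hh hg
      flex₆ := .of_dist φ hE hb ha he hd hc hf hh hg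
      flex₃ := .of_dist φ hE (symm hc) (symm hq) hf (symm ha) (symm hp) hr (symm he) hb
      flex₅ := .of_dist φ hE hg (symm hs) (symm hh) (symm hd) (symm hp) hr (symm he) hb
      flex₂ := .of_dist φ hE hc (symm hp) (symm hg) (symm hb) (symm hq) hs (symm hd) ha
      flex₄ := .of_dist φ hE (symm hf) (symm hr) hh (symm he) (symm hq) hs (symm hd) ha
      quad_x, quad_y, quad_z }

end IsRealization

theorem VariesOnUnitInterval.dense_ne {ξ : ℝ → ℝ} (h : VariesOnUnitInterval ξ) (k : ℝ) :
    Dense {t : Set.Icc (0 : ℝ) 1 | ξ t ≠ k} := by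
  rw [Metric.dense_iff]
  rintro ⟨t₀, ht₀, ht₀'⟩ ε hε
  have hlo : max 0 (t₀ - ε / 2) < min 1 (t₀ + ε / 2) :=
    max_lt (lt_min one_pos (by linarith)) (lt_min (by linarith) (by linarith))
  obtain ⟨t, ht, hne⟩ := h _ _ (le_max_left _ _) hlo (min_le_left _ _)
  obtain ⟨t', ht', hk⟩ : ∃ t' ∈ Set.Icc (max 0 (t₀ - ε / 2)) (min 1 (t₀ + ε / 2)), ξ t' ≠ k := by
    by_contra! hconst
    exact hne ((hconst t ht).trans (hconst _ (Set.left_mem_Icc.2 hlo.le)).symm)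
  rw [Set.mem_Icc, max_le_iff, le_min_iff] at ht'
  obtain ⟨⟨h₀, hge⟩, h₁, hle⟩ := ht'
  refine ⟨⟨t', h₀, h₁⟩, ?_, hk⟩
  rw [Metric.mem_ball, Subtype.dist_eq, Real.dist_eq, abs_lt]
  constructor <;> linarith

theorem NontriviallyFlexible.exists_genericFlex (h : K.NontriviallyFlexible) :
    ∃ (L : Type) (_ : Field L) (_ : Algebra ℝ L) (x y z : L), K.GenericFlex x y z := by
  obtain ⟨P, hP⟩ := h
  obtain ⟨L, _, _, φ, hφ⟩ := exists_field_transcendental (Set.Icc (0 : ℝ) 1) ℝ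
  have hcont (i : Fin 6) : Continuous fun t : Set.Icc (0 : ℝ) 1 => P t i :=
    (continuous_apply i).comp (continuousOn_iff_continuous_domRestrict.1 hP.continuousOn)
  have htrans {i j : Fin 6} (hij : VariesOnUnitInterval fun t => dist (P t i) (P t j)) :
      Transcendental ℝ (φ fun t => dist (P t i) (P t j)) :=
    hφ _ ((hcont i).dist (hcont j)) hij.dense_ne
  exact ⟨L, _, _, _, _, _, IsRealization.genericFlex (P := fun t : Set.Icc (0 : ℝ) 1 => P t)
    (fun t => hP.isRealization t t.2) φ (htrans hP.varies_x) (htrans hP.varies_y)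
    (htrans hP.varies_z)⟩

variable (K)

/-- The metric obtained by renaming the vertices along `v₁ → v₂ → v₃ → v₁`,
`v₄ → v₅ → v₆ → v₄`. -/
def rotate : OctahedronMetric where
  a := K.r
  b := K.f
  c := K.q
  d := K.e
  e := K.h
  f := K.s
  g := K.a
  h := K.d
  p := K.c
  q := K.p
  r := K.g
  s := K.b
  pos := by have := K.pos; tauto
  face_pqc := K.triangle_pqc.rot.rot
  face_qrf := K.triangle_spg.rot
  face_rsh := K.triangle_dbg.rot.swap
  face_spg := K.triangle_bac.rot.rot.swap
  face_bac := K.triangle_qrf.rot.swap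
  face_aef := K.triangle_rsh.rot.rot.swap
  face_edh := K.triangle_edh.rot.rot
  face_dbg := K.triangle_aef.rot

/-- The metric obtained by interchanging `v₂` with `v₃` and `v₄` with `v₅`. -/
def reflect : OctahedronMetric where
  a := K.b
  b := K.a
  c := K.c
  d := K.e
  e := K.d
  f := K.g
  g := K.f
  h := K.h
  p := K.q
  q := K.p
  r := K.s
  s := K.r
  pos := by have := K.pos; tauto
  face_pqc := K.triangle_pqc.swap
  face_qrf := K.triangle_spg.swap
  face_rsh := K.triangle_rsh.swap
  face_spg := K.triangle_qrf.swap
  face_bac := K.triangle_bac.swap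
  face_aef := K.triangle_dbg.swap
  face_edh := K.triangle_edh.swap
  face_dbg := K.triangle_aef.swap

namespace GenericFlex

variable {K} {L : Type*} [Field L] [Algebra ℝ L] {x y z : L}

theorem rotate (h : K.GenericFlex x y z) : K.rotate.GenericFlex y z x where
  trans_x := h.trans_y
  trans_y := h.trans_z
  trans_z := h.trans_x
  flex₁ := h.flex₂
  flex₆ := h.flex₄
  flex₃ := h.flex₁.reverse
  flex₅ := h.flex₆.reverse
  flex₂ := h.flex₃.reverse
  flex₄ := h.flex₅.reverse
  quad_x := h.quad_y
  quad_y := h.quad_z.reverse.rotate.rotate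
  quad_z := h.quad_x.reverse.rotate.rotate

theorem reflect (h : K.GenericFlex x y z) : K.reflect.GenericFlex y x z where
  trans_x := h.trans_y
  trans_y := h.trans_x
  trans_z := h.trans_z
  flex₁ := h.flex₁.reverse
  flex₆ := h.flex₆.reverse
  flex₃ := h.flex₂
  flex₅ := h.flex₄
  flex₂ := h.flex₃
  flex₄ := h.flex₅
  quad_x := h.quad_y.reverse.rotate
  quad_y := h.quad_x.reverse.rotate
  quad_z := h.quad_z.reverse.rotate.rotate.rotate

end GenericFlex

end OctahedronMetric

/-- Four times the area of the triangle with sides `a`, `b`, `c`, by Heron's formula. -/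
noncomputable def fourArea (a b c : ℝ) : ℝ :=
  √(2 * a ^ 2 * b ^ 2 + 2 * b ^ 2 * c ^ 2 + 2 * c ^ 2 * a ^ 2 - a ^ 4 - b ^ 4 - c ^ 4)

theorem fourArea_left_comm (a b c : ℝ) : fourArea a b c = fourArea b a c := by
  rw [fourArea, fourArea]
  ring_nf

theorem fourArea_right_comm (a b c : ℝ) : fourArea a b c = fourArea a c b := by
  rw [fourArea, fourArea]
  ring_nf

namespace IsTriangle

variable {u v l u' v' l' : ℝ}

theorem heron_eq (h : IsTriangle u v l) :
    2 * u ^ 2 * v ^ 2 + 2 * v ^ 2 * l ^ 2 + 2 * l ^ 2 * u ^ 2 - u ^ 4 - v ^ 4 - l ^ 4 =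
      4 * (u * v) ^ 2 * (1 - cosOfSq u v (l ^ 2) ^ 2) := by
  have hcos : 2 * u * v * cosOfSq u v (l ^ 2) = u ^ 2 + v ^ 2 - l ^ 2 :=
    mul_cosOfSq h.pos_left h.swap.pos_left _
  linear_combination (2 * u * v * cosOfSq u v (l ^ 2) + (u ^ 2 + v ^ 2 - l ^ 2)) * hcos

theorem fourArea_pos (h : IsTriangle u v l) : 0 < fourArea u v l := by
  have hu := h.pos_left
  have hv := h.swap.pos_left
  have hcos := sub_pos.2 h.cosOfSq_sq_lt_one
  rw [fourArea, Real.sqrt_pos, h.heron_eq]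
  positivity

theorem fourArea_sq (h : IsTriangle u v l) :
    fourArea u v l ^ 2 = 4 * (u * v) ^ 2 * (1 - cosOfSq u v (l ^ 2) ^ 2) := by
  rw [← h.heron_eq]
  exact Real.sq_sqrt (Real.sqrt_pos.1 h.fourArea_pos).le

theorem fourArea_mul_of_cosOfSq_eq (h : IsTriangle u v l) (h' : IsTriangle u' v' l') {κ : ℝ}
    (hκ : κ ^ 2 = 1) (hcos : cosOfSq u v (l ^ 2) = κ * cosOfSq u' v' (l' ^ 2)) :
    fourArea u v l * (u' * v') = fourArea u' v' l' * (u * v) := by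
  have hu := h.pos_left
  have hv := h.swap.pos_left
  have hu' := h'.pos_left
  have hv' := h'.swap.pos_left
  have hS := h.fourArea_pos
  have hS' := h'.fourArea_pos
  refine (sq_eq_sq₀ (by positivity) (by positivity)).1 ?_
  rw [mul_pow, mul_pow (fourArea u' v' l'), h.fourArea_sq, h'.fourArea_sq, hcos, mul_pow κ, hκ]
  ring

end IsTriangle

theorem cosOfSq_cross_mul {u v x u' v' x' κ : ℝ} (hu : 0 < u) (hv : 0 < v) (hu' : 0 < u')
    (hv' : 0 < v') (h : cosOfSq u v x = κ * cosOfSq u' v' x') :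
    (u ^ 2 + v ^ 2 - x) * (u' * v') = κ * (u' ^ 2 + v' ^ 2 - x') * (u * v) := by
  have hcos : 2 * u * v * cosOfSq u v x = u ^ 2 + v ^ 2 - x := mul_cosOfSq hu hv x
  have hcos' : 2 * u' * v' * cosOfSq u' v' x' = u' ^ 2 + v' ^ 2 - x' := mul_cosOfSq hu' hv' x'
  rw [← hcos, ← hcos', h]
  ring

theorem eq_or_mul_eq_of_cosOfSq {u v p r q s κ : ℝ} (hu : 0 < u) (hv : 0 < v) (hq : 0 < q)
    (hs : 0 < s) (hκ : κ ^ 2 = 1) (h₁ : cosOfSq u q (p ^ 2) = κ * cosOfSq q v (r ^ 2))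
    (h₂ : cosOfSq s u (r ^ 2) = κ * cosOfSq v s (p ^ 2)) :
    u = v ∨ u * v = |(q ^ 2 + s ^ 2 - p ^ 2 - r ^ 2) / 2| := by
  have e₁ : (u ^ 2 + q ^ 2 - p ^ 2) * v = κ * (q ^ 2 + v ^ 2 - r ^ 2) * u :=
    mul_right_cancel₀ hq.ne' (by linear_combination cosOfSq_cross_mul hu hq hq hv h₁)
  have e₂ : (s ^ 2 + u ^ 2 - r ^ 2) * v = κ * (v ^ 2 + s ^ 2 - p ^ 2) * u :=
    mul_right_cancel₀ hs.ne' (by linear_combination cosOfSq_cross_mul hs hu hv hs h₂)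
  have hfactor : (u - κ * v) * (κ * (u * v) - (q ^ 2 + s ^ 2 - p ^ 2 - r ^ 2) / 2) = 0 := by
    linear_combination (κ / 2) * (e₁ + e₂) + (u / 2) * (q ^ 2 + s ^ 2 - p ^ 2 - r ^ 2) * hκ
  have hκ_abs : |κ| = 1 := by rcases sq_eq_one_iff.1 hκ with rfl | rfl <;> norm_num
  rcases mul_eq_zero.1 hfactor with h | h
  · left
    rw [← abs_of_pos hu, sub_eq_zero.1 h, abs_mul, hκ_abs, one_mul, abs_of_pos hv]
  · right
    rw [← sub_eq_zero.1 h, abs_mul, hκ_abs, one_mul, abs_of_pos (mul_pos hu hv)]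

namespace VertexFigure

variable {u₁ w₁ u₂ w₂ l₁ l₂ l₃ l₄ : ℝ} {t₁ : IsTriangle u₁ w₁ l₁}
  {t₂ : IsTriangle w₁ u₂ l₂} {t₃ : IsTriangle u₂ w₂ l₃} {t₄ : IsTriangle w₂ u₁ l₄}

theorem Deltoid.fourArea_mul {κ : ℝ} (h : (ofLengths t₁ t₂ t₃ t₄).Deltoid κ) :
    fourArea u₁ w₁ l₁ * u₂ = fourArea w₁ u₂ l₂ * u₁ ∧
      fourArea w₂ u₁ l₄ * u₂ = fourArea u₂ w₂ l₃ * u₁ := by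
  obtain ⟨hκ, hα, hδ⟩ := h
  constructor
  · refine mul_right_cancel₀ t₂.pos_left.ne' ?_
    linear_combination t₁.fourArea_mul_of_cosOfSq_eq t₂ hκ hα
  · refine mul_right_cancel₀ t₄.pos_left.ne' ?_
    linear_combination t₄.fourArea_mul_of_cosOfSq_eq t₃ hκ hδ

theorem Isogram.fourArea_mul {ε : ℝ} (h : (ofLengths t₁ t₂ t₃ t₄).Isogram ε) :
    fourArea u₁ w₁ l₁ * (u₂ * w₂) = fourArea u₂ w₂ l₃ * (u₁ * w₁) ∧
      fourArea w₁ u₂ l₂ * (w₂ * u₁) = fourArea w₂ u₁ l₄ * (w₁ * u₂) :=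
  ⟨t₁.fourArea_mul_of_cosOfSq_eq t₃ h.1 h.2.1, t₂.fourArea_mul_of_cosOfSq_eq t₄ h.1 h.2.2⟩

end VertexFigure

section Equators

variable {w x y z : ℝ}

namespace IsQuadrilateral

variable {ρ σ τ ρ' σ' : ℝ}

theorem mul_signs_eq_one (hq : IsQuadrilateral w x y z) (hρ : ρ ^ 2 = 1) (hσ : σ ^ 2 = 1)
    (hτ : τ ^ 2 = 1) (h : w + ρ * x + σ * y + τ * z = 0) : ρ * σ * τ = 1 := by
  obtain ⟨hw, hx, hy, hz⟩ := hq
  rcases sq_eq_one_iff.1 hρ with rfl | rfl <;> rcases sq_eq_one_iff.1 hσ with rfl | rfl <;>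
    rcases sq_eq_one_iff.1 hτ with rfl | rfl <;> linarith

theorem exists_signed_sum_eq_zero (hq : IsQuadrilateral w x y z) (hσ : σ ^ 2 = 1)
    (hσ' : σ' ^ 2 = 1) (h : (w + σ * x) ^ 2 = (z + σ' * y) ^ 2) :
    ∃ τ : ℝ, τ ^ 2 = 1 ∧ w + σ * x + σ * τ * y + τ * z = 0 := by
  rcases sq_eq_sq_iff_eq_or_eq_neg.1 h with h | h
  · have hsign : σ * -σ' * -1 = 1 :=
      hq.mul_signs_eq_one hσ (by rwa [neg_sq]) (by norm_num) (by linear_combination h)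
    exact ⟨-1, by norm_num, by linear_combination h + σ * y * hσ' - σ' * y * hsign⟩
  · have hsign : σ * σ' * 1 = 1 :=
      hq.mul_signs_eq_one hσ hσ' (by norm_num) (by linear_combination h)
    exact ⟨1, by norm_num, by linear_combination h + σ' * y * hsign - σ * y * hσ'⟩

theorem equatorZeroSum (hq : IsQuadrilateral w x y z) (hσ : σ ^ 2 = 1) (hσ' : σ' ^ 2 = 1)
    (h : (w + σ * x) ^ 2 = (z + σ' * y) ^ 2) : OctahedronMetric.EquatorZeroSum w x y z := by
  obtain ⟨τ, hτ, hsum⟩ := hq.exists_signed_sum_eq_zero hσ hσ' h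
  obtain ⟨hw, hx, hy, hz⟩ := hq
  have hpos : w + x + y + z ≠ 0 := by linarith
  refine (mul_eq_zero.1 (?_ : (w + x + y + z) * _ = 0)).resolve_left hpos
  rcases sq_eq_one_iff.1 hσ with rfl | rfl <;> rcases sq_eq_one_iff.1 hτ with rfl | rfl
  · linear_combination (w + x - y - z) * (w - x + y - z) * (w - x - y + z) * hsum
  · linear_combination (w + x + y + z) * (w - x + y - z) * (w - x - y + z) * hsum
  · linear_combination (w + x + y + z) * (w + x - y - z) * (w - x + y - z) * hsum
  · linear_combination (w + x + y + z) * (w + x - y - z) * (w - x - y + z) * hsum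

theorem signed_sum_eq_zero_or_opposite_eq (hq : IsQuadrilateral w x y z) (hσ : σ ^ 2 = 1)
    (hσ' : σ' ^ 2 = 1) (h : (w + σ * x) ^ 2 = (z + σ' * y) ^ 2) (hρ : ρ ^ 2 = 1)
    (hρ' : ρ' ^ 2 = 1) (h' : (w + ρ * z) ^ 2 = (x + ρ' * y) ^ 2) :
    w + σ * x + ρ * z + σ * ρ * y = 0 ∨ w = y ∧ x = z := by
  obtain ⟨τ, hτ, hsum⟩ := hq.exists_signed_sum_eq_zero hσ hσ' h
  obtain ⟨τ', hτ', hsum'⟩ :=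
    hq.reverse.rotate.rotate.rotate.exists_signed_sum_eq_zero hρ hρ' h'
  rcases sq_eq_sq_iff_eq_or_eq_neg.1 (hτ.trans hρ.symm) with rfl | rfl
  · exact .inl (by linear_combination hsum)
  rcases sq_eq_sq_iff_eq_or_eq_neg.1 (hτ'.trans hσ.symm) with rfl | rfl
  · exact .inl (by linear_combination hsum')
  right
  have hwy : w = ρ * σ * y := by linear_combination (hsum + hsum') / 2
  have hxz : x = ρ * σ * z := by linear_combination σ * (hsum - hsum') / 2 - x * hσ
  obtain ⟨hw, -, hy, -⟩ := hq
  rcases sq_eq_one_iff.1 (show (ρ * σ) ^ 2 = 1 by rw [mul_pow, hρ, hσ, one_mul]) with h | h <;>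
    rw [h] at hwy hxz <;> constructor <;> linarith

end IsQuadrilateral

namespace OctahedronMetric

theorem EquatorSymmetric.rotate (h : EquatorSymmetric w x y z) : EquatorSymmetric x y z w := by
  unfold EquatorSymmetric at *
  grind

theorem EquatorSymmetric.swap (h : EquatorSymmetric w x y z) : EquatorSymmetric x w z y := by
  unfold EquatorSymmetric at *
  grind

theorem EquatorSymmetric.swap_middle (h : EquatorSymmetric w x y z) :
    EquatorSymmetric w y x z := by
  unfold EquatorSymmetric at *
  grind

namespace EquatorZeroSum

theorem rotate (h : EquatorZeroSum w x y z) : EquatorZeroSum x y z w := by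
  unfold EquatorZeroSum at *
  linear_combination h

theorem swap (h : EquatorZeroSum w x y z) : EquatorZeroSum x w z y := by
  unfold EquatorZeroSum at *
  linear_combination h

theorem swap_middle (h : EquatorZeroSum w x y z) : EquatorZeroSum w y x z := by
  unfold EquatorZeroSum at *
  linear_combination h

theorem equatorSymmetric_of_mul_eq (h : EquatorZeroSum w x y z) (hw : 0 < w) (hx : 0 < x)
    (hz : 0 < z) (hm : w * y = x * z) : EquatorSymmetric w x y z := by
  rcases mul_eq_zero.1 h with h | h
  · rcases mul_eq_zero.1 h with h | h
    · have hxy : x = y := mul_left_cancel₀ (add_pos hw hx).ne' (by linear_combination x * h - hm)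
      exact .inr (.inr ⟨by linarith, hxy⟩)
    · have hfactor : (w - x) * (w - z) = 0 := by linear_combination w * h - hm
      rcases mul_eq_zero.1 hfactor with hwx | hwz
      · exact .inr (.inl ⟨by linarith, by linarith⟩)
      · exact .inr (.inr ⟨by linarith, by linarith⟩)
  · have hyz : y = z := mul_left_cancel₀ (add_pos hw hz).ne' (by linear_combination hm - z * h)
    exact .inr (.inl ⟨by linarith, hyz⟩)

theorem eq_of_common_product {m : ℝ} (h : EquatorZeroSum w x w z) (hw : 0 < w)
    (hx : w = x ∨ w * x = m) (hz : w = z ∨ w * z = m) : x = z := by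
  have hfactor : (x - z) ^ 2 * (x + z - 2 * w) = 0 := by
    unfold EquatorZeroSum at h
    linear_combination h
  rcases mul_eq_zero.1 hfactor with hxz | hsum
  · exact sub_eq_zero.1 (pow_eq_zero_iff two_ne_zero |>.1 hxz)
  · rcases hx with rfl | hx
    · linarith
    · rcases hz with rfl | hz
      · linarith
      · exact mul_left_cancel₀ hw.ne' (hx.trans hz.symm)

theorem equatorSymmetric_of_common_product {m : ℝ} (h : EquatorZeroSum w x y z) (hw : 0 < w)
    (hx : 0 < x) (hy : 0 < y) (hz : 0 < z) (hwx : w = x ∨ w * x = m) (hxy : x = y ∨ x * y = m)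
    (hzy : z = y ∨ z * y = m) (hwz : w = z ∨ w * z = m) : EquatorSymmetric w x y z := by
  have hcases : w = y ∨ x = z ∨ w * y = x * z := by
    rcases hwx with rfl | hwx <;> rcases hxy with rfl | hxy
    · exact .inl rfl
    · rcases hzy with rfl | hzy
      · exact .inr (.inr rfl)
      · exact .inr (.inl (mul_right_cancel₀ hy.ne' (hxy.trans hzy.symm)))
    · rcases hwz with rfl | hwz
      · exact .inr (.inr (mul_comm _ _))
      · exact .inr (.inl (mul_left_cancel₀ hw.ne' (hwx.trans hwz.symm)))
    · exact .inl (mul_left_cancel₀ hx.ne' ((mul_comm x w).trans (hwx.trans hxy.symm)))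
  rcases hcases with rfl | rfl | hm
  · exact .inl ⟨rfl, h.eq_of_common_product hw hwx hwz⟩
  · rw [eq_comm, mul_comm] at hwx
    exact .inl ⟨(h.rotate.eq_of_common_product hx hxy hwx).symm, rfl⟩
  · exact h.equatorSymmetric_of_mul_eq hw hx hz hm

end EquatorZeroSum

end OctahedronMetric

end Equators

theorem mul_eq_of_area_ratios {c f h g p q r s S₁ S₂ S₃ S₄ : ℝ} (hg : 0 < g) (hS : 0 < S₁)
    (h₁₃ : S₁ * (r * s) = S₃ * (p * q)) (h₂₄ : S₂ * (s * p) = S₄ * (q * r))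
    (h₁₄ : S₁ * g = S₄ * c) (h₁₂ : S₁ * f = S₂ * c) (h₄₃ : S₄ * h = S₃ * g) :
    c * (r * s) = h * (p * q) ∧ f * (s * p) = g * (q * r) := by
  constructor
  · refine mul_left_cancel₀ (mul_pos hS hg).ne' ?_
    linear_combination c * g * h₁₃ - p * q * (h * h₁₄ + c * h₄₃)
  · refine mul_left_cancel₀ hS.ne' ?_
    linear_combination s * p * h₁₂ + c * h₂₄ - q * r * h₁₄

theorem eq_of_proportional {c h P Q P' Q' : ℝ} (hc : 0 < c) (hh : 0 < h) (hP : 0 < P)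
    (hP' : 0 < P') (heq : c * P = h * Q) (heq' : c * P' = h * Q') (hmul : P * P' = Q * Q') :
    c = h := by
  refine (sq_eq_sq₀ hc.le hh.le).1 (mul_right_cancel₀ (mul_pos hP hP').ne' ?_)
  linear_combination c * P' * heq + h * Q * heq' - h ^ 2 * hmul

theorem opposite_eq_of_pairings {q a s d : ℝ} (h : (q = s ∧ a = d) ∨ (q = d ∧ a = s))
    (h' : (q = a ∧ s = d) ∨ (q = d ∧ s = a)) : q = d ∧ a = s := by
  grind

theorem VertexFigure.SameAxis.mul_eq {V V' : VertexFigure} (h : V.SameAxis V') :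
    V.w₁ * V.w₂ = V'.w₁ * V'.w₂ := by
  rcases h with ⟨h₁, h₂⟩ | ⟨h₁, h₂⟩
  · rw [h₁, h₂]
  · rw [h₁, h₂, mul_comm]

namespace OctahedronMetric

variable {K : OctahedronMetric}

theorem opposite_eq_of_isogram_of_deltoid {ε₁ ε₆ κ₂ κ₃ κ₅ : ℝ} (h₁ : K.link₁.Isogram ε₁)
    (h₆ : K.link₆.Isogram ε₆) (h₂ : K.link₂.Deltoid κ₂) (h₃ : K.link₃.Deltoid κ₃)
    (h₅ : K.link₅.Deltoid κ₅) (hqa : K.q * K.a = K.s * K.d) (hpb : K.p * K.b = K.r * K.e) :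
    K.c = K.h ∧ K.f = K.g := by
  obtain ⟨-, hb, hc, hd, he, hf, hg, hh, hp, -, hr, hs⟩ := K.pos
  have hS₁ := K.triangle_pqc.fourArea_pos
  have hS₆ := K.triangle_bac.fourArea_pos
  have A₁ := h₁.fourArea_mul
  have A₆ := h₆.fourArea_mul
  have A₂ := h₂.fourArea_mul
  have A₃ := h₃.fourArea_mul
  have A₅ := h₅.fourArea_mul
  simp only [fourArea_left_comm, fourArea_right_comm] at hS₁ hS₆ A₁ A₆ A₂ A₃ A₅
  obtain ⟨hcrs, hfsp⟩ := mul_eq_of_area_ratios hg hS₁ A₁.1 A₁.2 A₂.1 A₃.1 A₅.1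
  obtain ⟨hced, hfdb⟩ := mul_eq_of_area_ratios hg hS₆ A₆.1 A₆.2 A₂.2 A₃.2 A₅.2
  exact ⟨eq_of_proportional hc hh (mul_pos hr hs) (mul_pos he hd) hcrs hced
      (by linear_combination -K.p * K.b * hqa - K.s * K.d * hpb),
    eq_of_proportional hf hg (mul_pos hs hp) (mul_pos hd hb) hfsp hfdb
      (by linear_combination -K.p * K.b * hqa + K.q * K.a * hpb)⟩

theorem equatorSymmetric_of_deltoid {κ₁ κ₃ κ₅ : ℝ} (hsum : EquatorZeroSum K.c K.f K.h K.g)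
    (h₁ : K.link₁.Deltoid κ₁) (h₃ : K.link₃.Deltoid κ₃) (h₅ : K.link₅.Deltoid κ₅) :
    EquatorSymmetric K.c K.f K.h K.g := by
  obtain ⟨-, -, hc, -, -, hf, hg, -, hp, -, hr, -⟩ := K.pos
  have hS₁ := K.triangle_pqc.fourArea_pos
  have hS₄ := K.triangle_spg.fourArea_pos
  have A₁ := h₁.fourArea_mul
  have A₃ := h₃.fourArea_mul
  have A₅ := h₅.fourArea_mul
  simp only [fourArea_left_comm, fourArea_right_comm] at hS₁ hS₄ A₁ A₃ A₅
  have hcr : K.c * K.r = K.f * K.p :=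
    mul_left_cancel₀ hS₁.ne' (by linear_combination K.c * A₁.1 - K.p * A₃.1)
  have hgr : K.g * K.r = K.h * K.p :=
    mul_left_cancel₀ hS₄.ne' (by linear_combination K.g * A₁.2 - K.p * A₅.1)
  refine hsum.equatorSymmetric_of_mul_eq hc hf hg (mul_right_cancel₀ (mul_pos hp hr).ne' ?_)
  linear_combination K.h * K.p * hcr - K.f * K.p * hgr

theorem equatorSymmetric_of_antipodal {κ₂ κ₃ κ₄ κ₅ : ℝ}
    (hsum : EquatorZeroSum K.c K.f K.h K.g) (hqd : K.q = K.d ∧ K.a = K.s)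
    (hpe : K.p = K.e ∧ K.b = K.r) (h₂ : K.link₂.Deltoid κ₂) (h₃ : K.link₃.Deltoid κ₃)
    (h₄ : K.link₄.Deltoid κ₄) (h₅ : K.link₅.Deltoid κ₅) :
    EquatorSymmetric K.c K.f K.h K.g := by
  obtain ⟨-, -, hc, -, -, hf, hg, hh, hp, hq, hr, hs⟩ := K.pos
  obtain ⟨hκ₂, hα₂, hδ₂⟩ := h₂
  obtain ⟨hκ₃, hα₃, hδ₃⟩ := h₃
  obtain ⟨hκ₄, hα₄, hδ₄⟩ := h₄
  obtain ⟨hκ₅, hα₅, hδ₅⟩ := h₅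
  simp only [link₂, link₃, link₄, link₅, VertexFigure.ofLengths, ← hqd.1, hqd.2, ← hpe.1, hpe.2]
    at hα₂ hδ₂ hα₃ hδ₃ hα₄ hδ₄ hα₅ hδ₅
  have hcf := eq_or_mul_eq_of_cosOfSq hc hf hq hs hκ₃ hα₃ hδ₃
  have hgh := eq_or_mul_eq_of_cosOfSq hg hh hs hq hκ₅ hα₅ hδ₅
  have hcg := eq_or_mul_eq_of_cosOfSq hc hg hp hr hκ₂ hα₂ hδ₂
  have hfh := eq_or_mul_eq_of_cosOfSq hf hh hr hp hκ₄ hα₄ hδ₄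
  rw [show K.s ^ 2 + K.q ^ 2 - K.p ^ 2 - K.r ^ 2 = K.q ^ 2 + K.s ^ 2 - K.p ^ 2 - K.r ^ 2 by ring]
    at hgh
  rw [show K.p ^ 2 + K.r ^ 2 - K.q ^ 2 - K.s ^ 2 = -(K.q ^ 2 + K.s ^ 2 - K.p ^ 2 - K.r ^ 2) by ring,
    neg_div, abs_neg] at hcg
  rw [show K.r ^ 2 + K.p ^ 2 - K.q ^ 2 - K.s ^ 2 = -(K.q ^ 2 + K.s ^ 2 - K.p ^ 2 - K.r ^ 2) by ring,
    neg_div, abs_neg] at hfh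
  exact hsum.equatorSymmetric_of_common_product hc hf hh hg hcf hfh hgh hcg

namespace GenericFlex

variable {L : Type*} [Field L] [Algebra ℝ L] {x y z : L}

theorem equatorSymmetric_of_notMem (h : K.GenericFlex x y z) (hxz : x ∉ ℝ⟮z⟯) :
    EquatorSymmetric K.c K.f K.h K.g := by
  have haxis : K.link₃.rotate.SameAxis K.link₅.rotate := by
    by_cases hzx : z ∈ ℝ⟮x⟯
    · exact h.flex₃.rotate.sameAxis_of_mem_notMem h.flex₅.rotate h.trans_z h.trans_x hzx hxz
    · exact h.flex₃.rotate.sameAxis_of_notMem_notMem h.flex₅.rotate h.trans_z h.trans_x hzx hxz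
  rcases haxis with ⟨hfh, hcg⟩ | ⟨hfg, hch⟩
  · exact .inr (.inr ⟨hcg, hfh⟩)
  · exact .inl ⟨hch, hfg⟩

theorem equatorZeroSum_of_mem (h : K.GenericFlex x y z) (hxz : x ∈ ℝ⟮z⟯) :
    EquatorZeroSum K.c K.f K.h K.g := by
  by_cases hzx : z ∈ ℝ⟮x⟯
  · obtain ⟨σ, τ, k, hpair⟩ := h.flex₃.exists_isogramPair h.flex₅ h.trans_x h.trans_z hxz hzx
    obtain ⟨σ', hσ', hpole⟩ := hpair.pole_x
    exact h.quad_z.equatorZeroSum hpair.σ_sq hσ' hpole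
  · obtain ⟨κ, h₃⟩ := h.flex₃.deltoid_of_mem_notMem h.trans_x h.trans_z hxz hzx
    obtain ⟨κ', h₅⟩ := h.flex₅.deltoid_of_mem_notMem h.trans_x h.trans_z hxz hzx
    have haxis := h.flex₃.sameAxis_of_mem_notMem h.flex₅ h.trans_x h.trans_z hxz hzx
    exact h.quad_z.equatorZeroSum h₃.1 h₅.1
      (h.flex₃.sq_add_eq_of_deltoid h.flex₅ h.trans_x h.trans_z haxis h₃ h₅)

theorem equatorSymmetric_of_adjoin_eq (h : K.GenericFlex x y z) (hxy : x ∈ ℝ⟮y⟯)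
    (hyx : y ∈ ℝ⟮x⟯) (hxz : x ∈ ℝ⟮z⟯) (hzx : z ∉ ℝ⟮x⟯) :
    EquatorSymmetric K.c K.f K.h K.g := by
  have hyz : y ∈ ℝ⟮z⟯ := adjoin_simple_le_iff.2 hxz hyx
  have hzy : z ∉ ℝ⟮y⟯ := fun hzy => hzx (adjoin_simple_le_iff.2 hyx hzy)
  have hx := h.trans_x
  have hy := h.trans_y
  have hz := h.trans_z
  obtain ⟨ε₁, h₁⟩ := h.flex₁.isogram_of_mem_mem hx hy hxy hyx
  obtain ⟨ε₆, h₆⟩ := h.flex₆.isogram_of_mem_mem hx hy hxy hyx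
  obtain ⟨κ₂, h₂⟩ := h.flex₂.deltoid_of_mem_notMem hy hz hyz hzy
  obtain ⟨κ₃, h₃⟩ := h.flex₃.deltoid_of_mem_notMem hx hz hxz hzx
  obtain ⟨κ₅, h₅⟩ := h.flex₅.deltoid_of_mem_notMem hx hz hxz hzx
  have haxis : K.link₃.SameAxis K.link₅ :=
    h.flex₃.sameAxis_of_mem_notMem h.flex₅ hx hz hxz hzx
  have haxis' : K.link₂.SameAxis K.link₄ :=
    h.flex₂.sameAxis_of_mem_notMem h.flex₄ hy hz hyz hzy
  exact .inl (opposite_eq_of_isogram_of_deltoid h₁ h₆ h₂ h₃ h₅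
    haxis.mul_eq haxis'.mul_eq)

theorem equatorSymmetric_of_mem_notMem (h : K.GenericFlex x y z) (hxy : x ∈ ℝ⟮y⟯)
    (hyx : y ∉ ℝ⟮x⟯) (hyz : y ∈ ℝ⟮z⟯) : EquatorSymmetric K.c K.f K.h K.g := by
  have hxz : x ∈ ℝ⟮z⟯ := adjoin_simple_le_iff.2 hyz hxy
  have hzx : z ∉ ℝ⟮x⟯ := fun hzx => hyx (adjoin_simple_le_iff.2 hzx hyz)
  obtain ⟨κ₁, h₁⟩ := h.flex₁.deltoid_of_mem_notMem h.trans_x h.trans_y hxy hyx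
  obtain ⟨κ₃, h₃⟩ := h.flex₃.deltoid_of_mem_notMem h.trans_x h.trans_z hxz hzx
  obtain ⟨κ₅, h₅⟩ := h.flex₅.deltoid_of_mem_notMem h.trans_x h.trans_z hxz hzx
  exact equatorSymmetric_of_deltoid (h.equatorZeroSum_of_mem hxz) h₁ h₃ h₅

theorem equatorSymmetric_of_notMem_notMem (h : K.GenericFlex x y z) (hxy : x ∉ ℝ⟮y⟯)
    (hyx : y ∉ ℝ⟮x⟯) (hxz : x ∈ ℝ⟮z⟯) (hyz : y ∈ ℝ⟮z⟯) :
    EquatorSymmetric K.c K.f K.h K.g := by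
  have hzx : z ∉ ℝ⟮x⟯ := fun hzx => hyx (adjoin_simple_le_iff.2 hzx hyz)
  have hzy : z ∉ ℝ⟮y⟯ := fun hzy => hxy (adjoin_simple_le_iff.2 hzy hxz)
  have hx := h.trans_x
  have hy := h.trans_y
  have hz := h.trans_z
  obtain ⟨κ₂, h₂⟩ := h.flex₂.deltoid_of_mem_notMem hy hz hyz hzy
  obtain ⟨κ₃, h₃⟩ := h.flex₃.deltoid_of_mem_notMem hx hz hxz hzx
  obtain ⟨κ₄, h₄⟩ := h.flex₄.deltoid_of_mem_notMem hy hz hyz hzy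
  obtain ⟨κ₅, h₅⟩ := h.flex₅.deltoid_of_mem_notMem hx hz hxz hzx
  have hqd : K.q = K.d ∧ K.a = K.s :=
    opposite_eq_of_pairings (h.flex₃.sameAxis_of_mem_notMem h.flex₅ hx hz hxz hzx)
      (h.flex₁.sameAxis_of_notMem_notMem h.flex₆ hx hy hxy hyx)
  have hpe : K.p = K.e ∧ K.b = K.r :=
    opposite_eq_of_pairings (h.flex₂.sameAxis_of_mem_notMem h.flex₄ hy hz hyz hzy)
      ((h.flex₁.rotate.sameAxis_of_notMem_notMem h.flex₆.rotate hy hx hyx hxy).imp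
        And.symm And.symm)
  exact equatorSymmetric_of_antipodal (h.equatorZeroSum_of_mem hxz) hqd hpe h₂ h₃ h₄ h₅

theorem equatorSymmetric (h : K.GenericFlex x y z) (hne : ¬(ℝ⟮x⟯ = ℝ⟮z⟯ ∧ ℝ⟮y⟯ = ℝ⟮z⟯)) :
    EquatorSymmetric K.c K.f K.h K.g := by
  have swap_reflect (hK : EquatorSymmetric K.c K.g K.h K.f) : EquatorSymmetric K.c K.f K.h K.g :=
    hK.swap.rotate
  have adjoin_eq {u v : L} (huv : u ∈ ℝ⟮v⟯) (hvu : v ∈ ℝ⟮u⟯) : ℝ⟮u⟯ = ℝ⟮v⟯ :=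
    le_antisymm (adjoin_simple_le_iff.2 huv) (adjoin_simple_le_iff.2 hvu)
  by_cases hxz : x ∈ ℝ⟮z⟯
  swap
  · exact h.equatorSymmetric_of_notMem hxz
  by_cases hyz : y ∈ ℝ⟮z⟯
  swap
  · exact swap_reflect (h.reflect.equatorSymmetric_of_notMem hyz)
  by_cases hxy : x ∈ ℝ⟮y⟯ <;> by_cases hyx : y ∈ ℝ⟮x⟯
  · refine h.equatorSymmetric_of_adjoin_eq hxy hyx hxz fun hzx => hne ⟨adjoin_eq hxz hzx, ?_⟩
    exact adjoin_eq hyz (adjoin_simple_le_iff.2 hxy hzx)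
  · exact h.equatorSymmetric_of_mem_notMem hxy hyx hyz
  · exact swap_reflect (h.reflect.equatorSymmetric_of_mem_notMem hyx hxy hxz)
  · exact h.equatorSymmetric_of_notMem_notMem hxy hyx hxz hyz

theorem typeA_of_adjoin_ne (h : K.GenericFlex x y z)
    (hne : ¬(ℝ⟮x⟯ = ℝ⟮z⟯ ∧ ℝ⟮y⟯ = ℝ⟮z⟯)) : K.TypeA :=
  ⟨h.equatorSymmetric hne,
    (h.rotate.rotate.equatorSymmetric
      fun hzx => hne ⟨hzx.2.trans hzx.1.symm, hzx.1.symm⟩).swap,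
    (h.rotate.equatorSymmetric fun hyz => hne ⟨hyz.2.symm, hyz.1.trans hyz.2.symm⟩).swap⟩

end GenericFlex

end OctahedronMetric

theorem mul_neg_of_bilinear_relations {L : Type*} [Field L] [Algebra ℝ L] {x y z : L}
    (hz : Transcendental ℝ z) {x₁ z₁ x₂ y₂ y₃ z₃ k₁ k₂ k₃ : ℝ} (hk₂ : k₂ ≠ 0) (hk₃ : k₃ ≠ 0)
    (hxz : (x - algebraMap ℝ L x₁) * (z - algebraMap ℝ L z₁) = algebraMap ℝ L k₁)
    (hxy : (x - algebraMap ℝ L x₂) * (y - algebraMap ℝ L y₂) = algebraMap ℝ L k₂)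
    (hyz : (y - algebraMap ℝ L y₃) * (z - algebraMap ℝ L z₃) = algebraMap ℝ L k₃) :
    k₁ * k₂ * k₃ < 0 := by
  obtain ⟨hlead, hmiddle, -⟩ : (x₁ - x₂) * (y₃ - y₂) - k₂ = 0 ∧
      k₁ * (y₃ - y₂) + k₃ * (x₁ - x₂) - ((x₁ - x₂) * (y₃ - y₂) - k₂) * (z₁ + z₃) = 0 ∧
      ((x₁ - x₂) * (y₃ - y₂) - k₂) * (z₁ * z₃) - k₁ * (y₃ - y₂) * z₃ - k₃ * (x₁ - x₂) * z₁
        + k₁ * k₃ = 0 := by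
    apply coeff_eq_zero_of_quadratic_eq_zero hz
    simp only [map_sub, map_mul, map_add]
    set ι := algebraMap ℝ L
    linear_combination (z - ι z₁) * (z - ι z₃) * hxy - (z - ι z₃) * (y - ι y₂) * hxz
      - (ι k₁ + (ι x₁ - ι x₂) * (z - ι z₁)) * hyz
  have hx : x₁ - x₂ ≠ 0 := by
    intro hx
    rw [hx, zero_mul, zero_sub, neg_eq_zero] at hlead
    exact hk₂ hlead
  have hprod : k₁ * k₂ * k₃ = -(k₃ * (x₁ - x₂)) ^ 2 := by
    linear_combination k₃ * (x₁ - x₂) * (hmiddle + (z₁ + z₃) * hlead) - k₁ * k₃ * hlead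
  rw [hprod, neg_lt_zero]
  positivity

theorem ratio_mul_eq {A B C m₁ m₂ m₃ n₁ n₂ n₃ : ℝ} (hB : 0 < B) (h₁ : A * m₁ = B * n₁)
    (h₂ : A * m₂ = C * n₂) (h₃ : C * m₃ = B * n₃) : n₁ * m₂ * m₃ = m₁ * n₂ * n₃ := by
  refine mul_left_cancel₀ hB.ne' ?_
  linear_combination (-m₂ * m₃) * h₁ + m₁ * m₃ * h₂ + m₁ * n₂ * h₃

section SignedB

/-- The polynomial `B₁₁₁` of the theorem with `h`, `s`, `r` negated, in arbitrary real variables.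
Inserting edge lengths with suitable signs gives all four polynomials `B`. -/
def signedB (a b c h s r : ℝ) : ℝ :=
  a * b * c * (h ^ 2 + s ^ 2 + r ^ 2) + h * s * r * (a ^ 2 + b ^ 2 + c ^ 2)
    - c * s * b * (h ^ 2 + r ^ 2 - s ^ 2) - h * r * a * (b ^ 2 + c ^ 2 - a ^ 2)
    - a * h * b * (s ^ 2 + r ^ 2 - h ^ 2) - s * r * c * (a ^ 2 + b ^ 2 - c ^ 2)
    - c * r * a * (s ^ 2 + h ^ 2 - r ^ 2) - s * h * b * (a ^ 2 + c ^ 2 - b ^ 2)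

variable {a b c d e g h p r s : ℝ}

theorem mul_signedB_eq_zero_of_angle_ab (ha : a ≠ 0) (hb : b ≠ 0) (hh : h ≠ 0)
    (he : e * (c * s - a * h) = (r + b) * (a * h)) (hd : d * (c * r - b * h) = (a + s) * (b * h))
    (hangle : (b ^ 2 + a ^ 2 - c ^ 2) * (e * d) = (e ^ 2 + d ^ 2 - h ^ 2) * (b * a)) :
    (a * b * c - a * b * h + a * c * r + b * c * s) * signedB a b c h s r = 0 := by
  have hsubst : (b ^ 2 + a ^ 2 - c ^ 2) * ((e * (c * s - a * h)) * (d * (c * r - b * h)))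
        * ((c * s - a * h) * (c * r - b * h)) =
      ((e * (c * s - a * h)) ^ 2 * (c * r - b * h) ^ 2
        + (d * (c * r - b * h)) ^ 2 * (c * s - a * h) ^ 2
        - h ^ 2 * (c * s - a * h) ^ 2 * (c * r - b * h) ^ 2) * (b * a) := by
    linear_combination (c * s - a * h) ^ 2 * (c * r - b * h) ^ 2 * hangle
  rw [he, hd] at hsubst
  refine (mul_eq_zero.1 (?_ : a * b * h ^ 2 * _ = 0)).resolve_left (by positivity)
  unfold signedB
  linear_combination -hsubst

theorem mul_signedB_eq_zero_of_angle_bc (hb : b ≠ 0) (hc : c ≠ 0) (hs : s ≠ 0)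
    (hp : p * (c * s - a * h) = -((r + b) * (c * s)))
    (hg : g * (r * a - s * b) = (c + h) * (s * b))
    (hangle : (p ^ 2 + g ^ 2 - s ^ 2) * (b * c) = (b ^ 2 + c ^ 2 - a ^ 2) * (p * g)) :
    (a * b * c + a * b * h + a * c * r - b * c * s) * signedB a b c h s r = 0 := by
  have hsubst : ((p * (c * s - a * h)) ^ 2 * (r * a - s * b) ^ 2
        + (g * (r * a - s * b)) ^ 2 * (c * s - a * h) ^ 2
        - s ^ 2 * (c * s - a * h) ^ 2 * (r * a - s * b) ^ 2) * (b * c) =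
      (b ^ 2 + c ^ 2 - a ^ 2) * ((p * (c * s - a * h)) * (g * (r * a - s * b)))
        * ((c * s - a * h) * (r * a - s * b)) := by
    linear_combination (c * s - a * h) ^ 2 * (r * a - s * b) ^ 2 * hangle
  rw [hp, hg] at hsubst
  refine (mul_eq_zero.1 (?_ : b * c * s ^ 2 * _ = 0)).resolve_left (by positivity)
  unfold signedB
  linear_combination hsubst

theorem signedB_eq_zero {f q : ℝ} (ha : a ≠ 0) (hb : b ≠ 0) (hc : c ≠ 0) (hh : h ≠ 0)
    (hs : s ≠ 0) (hrb : r + b ≠ 0) (hx : q + s + d + a = 0) (hy : p + r + e + b = 0)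
    (hz : c + f + h + g = 0) (hbhq : b * h * q = -(c * d * r)) (hrga : r * g * a = -(s * f * b))
    (haph : a * p * h = -(c * s * e))
    (hangle_ab : (b ^ 2 + a ^ 2 - c ^ 2) * (e * d) = (e ^ 2 + d ^ 2 - h ^ 2) * (b * a))
    (hangle_bc : (p ^ 2 + g ^ 2 - s ^ 2) * (b * c) = (b ^ 2 + c ^ 2 - a ^ 2) * (p * g)) :
    signedB a b c h s r = 0 := by
  have he : e * (c * s - a * h) = (r + b) * (a * h) := by linear_combination haph - a * h * hy
  have hd : d * (c * r - b * h) = (a + s) * (b * h) := by linear_combination hbhq - b * h * hx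
  have hp : p * (c * s - a * h) = -((r + b) * (c * s)) := by linear_combination c * s * hy - haph
  have hg : g * (r * a - s * b) = (c + h) * (s * b) := by linear_combination hrga - s * b * hz
  have hab := mul_signedB_eq_zero_of_angle_ab ha hb hh he hd hangle_ab
  have hbc := mul_signedB_eq_zero_of_angle_bc hb hc hs hp hg hangle_bc
  refine (mul_eq_zero.1 (?_ : 2 * (a * c * (r + b)) * _ = 0)).resolve_left (by positivity)
  linear_combination hab + hbc

end SignedB

namespace OctahedronMetric

variable {K : OctahedronMetric}

theorem signedB_signed_lengths (K : OctahedronMetric) {α β η θ ρ : ℝ} (hα : α ^ 2 = 1)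
    (hβ : β ^ 2 = 1) (hη : η ^ 2 = 1) (hθ : θ ^ 2 = 1) (hρ : ρ ^ 2 = 1)
    (hprod : α * β * η * θ * ρ = -1) :
    signedB (α * K.a) (β * K.b) K.c (η * K.h) (θ * K.s) (ρ * K.r) =
      α * β * K.B (-(α * θ)) (-η) (-(β * ρ)) := by
  have hηθρ : η * θ * ρ = -(α * β) := by
    linear_combination α * β * hprod - β ^ 2 * η * θ * ρ * hα - η * θ * ρ * hβ
  have hηρα : η * ρ * α = -(β * θ) := by
    linear_combination β * θ * hprod - θ ^ 2 * α * η * ρ * hβ - α * η * ρ * hθ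
  have hθρ : θ * ρ = -(α * β * η) := by
    linear_combination η * hηθρ - θ * ρ * hη
  have hθηβ : θ * η * β = -(α * ρ) := by
    linear_combination α * ρ * hprod - ρ ^ 2 * β * η * θ * hα - β * η * θ * hρ
  simp only [signedB, B, mul_pow, hα, hβ, hη, hθ, hρ, one_mul]
  linear_combination K.h * K.s * K.r * (K.a ^ 2 + K.b ^ 2 + K.c ^ 2) * hηθρ
    - K.h * K.r * K.a * (K.b ^ 2 + K.c ^ 2 - K.a ^ 2) * hηρα
    - K.s * K.r * K.c * (K.a ^ 2 + K.b ^ 2 - K.c ^ 2) * hθρ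
    - K.s * K.h * K.b * (K.a ^ 2 + K.c ^ 2 - K.b ^ 2) * hθηβ
    + β * θ * (K.c * K.s * K.b * (K.h ^ 2 + K.r ^ 2 - K.s ^ 2)
      - K.h * K.r * K.a * (K.b ^ 2 + K.c ^ 2 - K.a ^ 2)) * hα
    + α * ρ * (K.c * K.r * K.a * (K.s ^ 2 + K.h ^ 2 - K.r ^ 2)
      - K.s * K.h * K.b * (K.a ^ 2 + K.c ^ 2 - K.b ^ 2)) * hβ

theorem B_product_eq_zero {ε₁ ε₂ ε₃ : ℝ} (hε₁ : ε₁ ^ 2 = 1) (hε₂ : ε₂ ^ 2 = 1)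
    (hε₃ : ε₃ ^ 2 = 1) (hprod : ε₁ * ε₂ * ε₃ = 1) (hB : K.B ε₁ ε₂ ε₃ = 0) :
    K.B 1 1 1 * K.B 1 (-1) (-1) * K.B (-1) 1 (-1) * K.B (-1) (-1) 1 = 0 := by
  obtain rfl : ε₁ * ε₂ = ε₃ := by linear_combination ε₃ * hprod - ε₁ * ε₂ * hε₃
  rcases sq_eq_one_iff.1 hε₁ with rfl | rfl <;> rcases sq_eq_one_iff.1 hε₂ with rfl | rfl <;>
    simp only [one_mul, mul_one, neg_mul, neg_neg] at hB <;> simp [hB]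

/-- The equalities satisfied by the metric when opposite angles at each vertex are equal or add up
to `π`: all equators have zero sum, and the ratios of the areas of the faces, computed around a
vertex in different ways, agree. -/
structure IsBalanced (K : OctahedronMetric) : Prop where
  zeroSum_z : EquatorZeroSum K.c K.f K.h K.g
  zeroSum_y : EquatorZeroSum K.b K.p K.r K.e
  zeroSum_x : EquatorZeroSum K.s K.q K.a K.d
  qge_eq_pfd : K.q * K.g * K.e = K.p * K.f * K.d
  bhq_eq_cdr : K.b * K.h * K.q = K.c * K.d * K.r
  rga_eq_sfb : K.r * K.g * K.a = K.s * K.f * K.b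
  aph_eq_cse : K.a * K.p * K.h = K.c * K.s * K.e

theorem mul_eq_of_isogram {ε₁ ε₂ ε₃ ε₄ ε₅ ε₆ : ℝ} (h₁ : K.link₁.Isogram ε₁)
    (h₂ : K.link₂.Isogram ε₂) (h₃ : K.link₃.Isogram ε₃) (h₄ : K.link₄.Isogram ε₄)
    (h₅ : K.link₅.Isogram ε₅) (h₆ : K.link₆.Isogram ε₆) :
    K.q * K.g * K.e = K.p * K.f * K.d ∧ K.b * K.h * K.q = K.c * K.d * K.r ∧
      K.r * K.g * K.a = K.s * K.f * K.b ∧ K.a * K.p * K.h = K.c * K.s * K.e := by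
  obtain ⟨ha, -, hc, -, he, hf, -, hh, hp, hq, hr, hs⟩ := K.pos
  have hS_bac := K.triangle_bac.fourArea_pos
  have hS_aef := K.triangle_aef.fourArea_pos
  have hS_edh := K.triangle_edh.fourArea_pos
  have A₁ := h₁.fourArea_mul
  have A₂ := h₂.fourArea_mul
  have A₃ := h₃.fourArea_mul
  have A₄ := h₄.fourArea_mul
  have A₅ := h₅.fourArea_mul
  have A₆ := h₆.fourArea_mul
  simp only [fourArea_left_comm, fourArea_right_comm] at hS_bac hS_aef hS_edh A₁ A₂ A₃ A₄ A₅ A₆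
  refine ⟨?_, ?_, ?_, ?_⟩
  · refine mul_left_cancel₀ (mul_pos hr (mul_pos hs hh)).ne' ?_
    linear_combination -ratio_mul_eq hS_edh A₄.1 A₁.2 A₅.1
  · refine mul_left_cancel₀ (mul_pos hf (mul_pos ha he)).ne' ?_
    linear_combination -ratio_mul_eq hS_edh A₄.1 A₃.2 A₆.1
  · refine mul_left_cancel₀ (mul_pos hq (mul_pos hp hc)).ne' ?_
    linear_combination -ratio_mul_eq hS_bac A₃.2 A₁.2 A₂.2
  · refine mul_left_cancel₀ (mul_pos hq (mul_pos hr hf)).ne' ?_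
    linear_combination -ratio_mul_eq hS_aef A₃.1 A₁.1 A₄.2

theorem typeA_of_rotate (h : K.rotate.TypeA) : K.TypeA :=
  ⟨h.2.1.swap, h.2.2, h.1.swap⟩

namespace IsBalanced

theorem rotate (h : K.IsBalanced) : K.rotate.IsBalanced where
  zeroSum_z := h.zeroSum_x.swap
  zeroSum_y := h.zeroSum_z.swap
  zeroSum_x := h.zeroSum_y
  qge_eq_pfd := by
    simp only [OctahedronMetric.rotate]
    linear_combination h.aph_eq_cse
  bhq_eq_cdr := by
    simp only [OctahedronMetric.rotate]
    linear_combination -h.qge_eq_pfd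
  rga_eq_sfb := by
    simp only [OctahedronMetric.rotate]
    linear_combination h.rga_eq_sfb
  aph_eq_cse := by
    simp only [OctahedronMetric.rotate]
    linear_combination -h.bhq_eq_cdr

theorem typeA_of_opposite_eq (h : K.IsBalanced) (hch : K.c = K.h) (hfg : K.f = K.g) :
    K.TypeA := by
  obtain ⟨-, hb, -, hd, he, -, hg, hh, -, hq, hr, hs⟩ := K.pos
  have hbq : K.b * K.q = K.d * K.r :=
    mul_right_cancel₀ hh.ne' (by linear_combination h.bhq_eq_cdr + K.d * K.r * hch)
  have hqe : K.q * K.e = K.p * K.d :=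
    mul_right_cancel₀ hg.ne' (by linear_combination h.qge_eq_pfd + K.p * K.d * hfg)
  have hra : K.r * K.a = K.s * K.b :=
    mul_right_cancel₀ hg.ne' (by linear_combination h.rga_eq_sfb + K.s * K.b * hfg)
  have hbp : K.b * K.p = K.r * K.e := mul_left_cancel₀ (mul_pos hq hd).ne' (by
    linear_combination K.p * K.d * hbq - K.d * K.r * hqe)
  have hqa : K.q * K.a = K.d * K.s := mul_left_cancel₀ (mul_pos hb hr).ne' (by
    linear_combination K.r * K.a * hbq + K.d * K.r * hra)
  refine ⟨.inl ⟨hch, hfg⟩, ?_, ?_⟩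
  · exact (h.zeroSum_y.swap_middle.equatorSymmetric_of_mul_eq hb hr he hbp).swap_middle
  · exact (h.zeroSum_x.rotate.swap_middle.equatorSymmetric_of_mul_eq hq hd hs
      hqa).swap_middle.rotate.rotate.rotate

theorem mul_eq_neg_of_signs (h : K.IsBalanced) {σ₁ σ₂ σ₃ τ₁ τ₂ τ₃ : ℝ} (hσ₁ : σ₁ ^ 2 = 1)
    (hσ₃ : σ₃ ^ 2 = 1) (hτ₁ : τ₁ ^ 2 = 1) (hτ₂ : τ₂ ^ 2 = 1) (hτ₃ : τ₃ ^ 2 = 1)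
    (hsign : σ₃ * τ₃ * (σ₁ * τ₁) * (σ₂ * τ₂) = -1) :
    τ₂ * K.b * (σ₃ * σ₂ * K.h) * K.q = -(K.c * (τ₃ * τ₁ * K.d) * (σ₁ * K.r)) ∧
      σ₁ * K.r * (σ₂ * K.g) * (τ₃ * K.a) = -(τ₁ * K.s * (σ₃ * K.f) * (τ₂ * K.b)) ∧
      τ₃ * K.a * K.p * (σ₃ * σ₂ * K.h) = -(K.c * (τ₁ * K.s) * (σ₁ * τ₂ * K.e)) := by
  have sq_eq_one {ε₁ ε₂ ε₃ : ℝ} (h₁ : ε₁ ^ 2 = 1) (h₂ : ε₂ ^ 2 = 1) (h₃ : ε₃ ^ 2 = 1) :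
      (ε₁ * ε₂ * ε₃) ^ 2 = 1 := by
    rw [mul_pow, mul_pow, h₁, h₂, h₃, one_mul, one_mul]
  have eq_neg {ε δ : ℝ} (hδ : δ ^ 2 = 1) (h : ε * δ = -1) : ε = -δ := by
    linear_combination δ * h - ε * hδ
  have hsign_bhq : τ₂ * σ₃ * σ₂ = -(τ₃ * τ₁ * σ₁) :=
    eq_neg (sq_eq_one hτ₃ hτ₁ hσ₁) (by linear_combination hsign)
  have hsign_rga : σ₁ * σ₂ * τ₃ = -(τ₁ * σ₃ * τ₂) :=
    eq_neg (sq_eq_one hτ₁ hσ₃ hτ₂) (by linear_combination hsign)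
  have hsign_aph : τ₃ * σ₃ * σ₂ = -(τ₁ * σ₁ * τ₂) :=
    eq_neg (sq_eq_one hτ₁ hσ₁ hτ₂) (by linear_combination hsign)
  refine ⟨?_, ?_, ?_⟩
  · linear_combination τ₂ * σ₃ * σ₂ * h.bhq_eq_cdr + K.c * K.d * K.r * hsign_bhq
  · linear_combination σ₁ * σ₂ * τ₃ * h.rga_eq_sfb + K.s * K.f * K.b * hsign_rga
  · linear_combination τ₃ * σ₃ * σ₂ * h.aph_eq_cse + K.c * K.s * K.e * hsign_aph

end IsBalanced

theorem B_eq_zero_of_signed_sums {σ₁ σ₂ σ₃ τ₁ τ₂ τ₃ : ℝ} (hσ₁ : σ₁ ^ 2 = 1) (hσ₂ : σ₂ ^ 2 = 1)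
    (hσ₃ : σ₃ ^ 2 = 1) (hτ₁ : τ₁ ^ 2 = 1) (hτ₂ : τ₂ ^ 2 = 1) (hτ₃ : τ₃ ^ 2 = 1)
    (hsign : σ₃ * τ₃ * (σ₁ * τ₁) * (σ₂ * τ₂) = -1) (hK : K.IsBalanced)
    (hne : ¬(K.p = K.e ∧ K.r = K.b))
    (hx : K.q + τ₃ * K.a + τ₁ * K.s + τ₃ * τ₁ * K.d = 0)
    (hy : K.p + σ₁ * K.r + τ₂ * K.b + σ₁ * τ₂ * K.e = 0)
    (hz : K.c + σ₃ * K.f + σ₂ * K.g + σ₃ * σ₂ * K.h = 0)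
    (h₆ : K.link₆.Isogram (σ₁ * τ₁)) (h₂ : K.link₂.Isogram (σ₂ * τ₂)) :
    K.B (-(τ₃ * τ₁)) (-(σ₃ * σ₂)) (-(τ₂ * σ₁)) = 0 := by
  obtain ⟨ha, hb, hc, hd, he, -, hg, hh, hp, -, hr, hs⟩ := K.pos
  have ne_zero {ε : ℝ} (hε : ε ^ 2 = 1) : ε ≠ 0 := by
    rintro rfl
    norm_num at hε
  have hσ₃₂ : (σ₃ * σ₂) ^ 2 = 1 := by rw [mul_pow, hσ₃, hσ₂, one_mul]
  have hrb : σ₁ * K.r + τ₂ * K.b ≠ 0 := by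
    intro hrb
    rcases sq_eq_one_iff.1 hσ₁ with rfl | rfl <;> rcases sq_eq_one_iff.1 hτ₂ with rfl | rfl <;>
      exact hne ⟨by linarith, by linarith⟩
  obtain ⟨hbhq, hrga, haph⟩ := hK.mul_eq_neg_of_signs hσ₁ hσ₃ hτ₁ hτ₂ hτ₃ hsign
  have hangle_ab := cosOfSq_cross_mul hb ha he hd h₆.2.1
  have hangle_bc := cosOfSq_cross_mul hp hg hb hc h₂.2.2
  have hB : signedB (τ₃ * K.a) (τ₂ * K.b) K.c (σ₃ * σ₂ * K.h) (τ₁ * K.s) (σ₁ * K.r) = 0 := by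
    apply signedB_eq_zero (d := τ₃ * τ₁ * K.d) (e := σ₁ * τ₂ * K.e) (f := σ₃ * K.f)
      (g := σ₂ * K.g) (p := K.p) (q := K.q) (mul_ne_zero (ne_zero hτ₃) ha.ne')
      (mul_ne_zero (ne_zero hτ₂) hb.ne') hc.ne' (mul_ne_zero (ne_zero hσ₃₂) hh.ne')
      (mul_ne_zero (ne_zero hτ₁) hs.ne') hrb
    · linear_combination hx
    · linear_combination hy
    · linear_combination hz
    · exact hbhq
    · exact hrga
    · exact haph
    · simp only [mul_pow, hσ₁, hσ₂, hσ₃, hτ₁, hτ₂, hτ₃, one_mul]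
      linear_combination σ₁ * τ₁ * τ₂ * τ₃ * hangle_ab
        + τ₂ * τ₃ * (K.e ^ 2 + K.d ^ 2 - K.h ^ 2) * (K.b * K.a) * (τ₁ ^ 2 * hσ₁ + hτ₁)
    · simp only [mul_pow, hσ₂, hτ₁, hτ₂, hτ₃, one_mul]
      linear_combination τ₂ * hangle_bc
        + σ₂ * (K.b ^ 2 + K.c ^ 2 - K.a ^ 2) * (K.p * K.g) * hτ₂
  rw [signedB_signed_lengths K hτ₃ hτ₂ hσ₃₂ hτ₁ hσ₁ (by linear_combination hsign)] at hB
  exact (mul_eq_zero.1 hB).resolve_left (mul_ne_zero (ne_zero hτ₃) (ne_zero hτ₂))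

namespace GenericFlex

variable {L : Type*} [Field L] [Algebra ℝ L] {x y z : L} {σ₁ σ₂ σ₃ τ₁ τ₂ τ₃ k₁ k₂ k₃ : ℝ}

theorem mul_signs_eq_neg_one (h : K.GenericFlex x y z)
    (h₁₆ : K.link₁.IsogramPair K.link₆ x y σ₁ τ₁ k₁)
    (h₂₄ : K.link₂.IsogramPair K.link₄ y z σ₂ τ₂ k₂)
    (h₃₅ : K.link₃.IsogramPair K.link₅ x z σ₃ τ₃ k₃) :
    σ₃ * τ₃ * (σ₁ * τ₁) * (σ₂ * τ₂) = -1 := by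
  have hk : k₃ * k₁ * k₂ < 0 := mul_neg_of_bilinear_relations h.trans_z
    (right_ne_zero_of_mul h₁₆.pos.ne') (right_ne_zero_of_mul h₂₄.pos.ne')
    h₃₅.bilinear h₁₆.bilinear h₂₄.bilinear
  have hpos : 0 < σ₃ * τ₃ * (σ₁ * τ₁) * (σ₂ * τ₂) * (k₃ * k₁ * k₂) := by
    linarith [mul_pos (mul_pos h₃₅.pos h₁₆.pos) h₂₄.pos]
  have hsq : (σ₃ * τ₃ * (σ₁ * τ₁) * (σ₂ * τ₂)) ^ 2 = 1 := by
    simp only [mul_pow, h₁₆.σ_sq, h₁₆.τ_sq, h₂₄.σ_sq, h₂₄.τ_sq, h₃₅.σ_sq, h₃₅.τ_sq, one_mul]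
  refine (sq_eq_one_iff.1 hsq).resolve_left fun hone => ?_
  rw [hone, one_mul] at hpos
  exact hpos.not_gt hk

theorem isBalanced (h : K.GenericFlex x y z) (h₁₆ : K.link₁.IsogramPair K.link₆ x y σ₁ τ₁ k₁)
    (h₂₄ : K.link₂.IsogramPair K.link₄ y z σ₂ τ₂ k₂)
    (h₃₅ : K.link₃.IsogramPair K.link₅ x z σ₃ τ₃ k₃) : K.IsBalanced := by
  obtain ⟨σ', hσ', hpole_z⟩ := h₃₅.pole_x
  obtain ⟨ρ', hρ', hpole_y⟩ := h₁₆.pole_x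
  obtain ⟨τ', hτ', hpole_x⟩ := h₃₅.pole_z
  obtain ⟨hqge, hbhq, hrga, haph⟩ := mul_eq_of_isogram h₁₆.isogram h₂₄.isogram h₃₅.isogram
    h₂₄.isogram' h₃₅.isogram' h₁₆.isogram'
  exact
    { zeroSum_z := h.quad_z.equatorZeroSum h₃₅.σ_sq hσ' hpole_z
      zeroSum_y :=
        (h.quad_y.rotate.equatorZeroSum h₁₆.σ_sq hρ' hpole_y).rotate.rotate.rotate
      zeroSum_x :=
        (h.quad_x.rotate.equatorZeroSum h₃₅.τ_sq hτ' hpole_x).rotate.rotate.rotate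
      qge_eq_pfd := hqge
      bhq_eq_cdr := hbhq
      rga_eq_sfb := hrga
      aph_eq_cse := haph }

theorem typeA_or_signed_sums_eq_zero (h : K.GenericFlex x y z)
    (h₁₆ : K.link₁.IsogramPair K.link₆ x y σ₁ τ₁ k₁)
    (h₂₄ : K.link₂.IsogramPair K.link₄ y z σ₂ τ₂ k₂)
    (h₃₅ : K.link₃.IsogramPair K.link₅ x z σ₃ τ₃ k₃) :
    K.TypeA ∨ ¬(K.p = K.e ∧ K.r = K.b) ∧
      K.q + τ₃ * K.a + τ₁ * K.s + τ₃ * τ₁ * K.d = 0 ∧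
      K.p + σ₁ * K.r + τ₂ * K.b + σ₁ * τ₂ * K.e = 0 ∧
      K.c + σ₃ * K.f + σ₂ * K.g + σ₃ * σ₂ * K.h = 0 := by
  have hK := h.isBalanced h₁₆ h₂₄ h₃₅
  obtain ⟨_, hσ₁', hp₁⟩ := h₁₆.pole_x
  obtain ⟨_, hτ₁', hq₁⟩ := h₁₆.pole_z
  obtain ⟨_, hσ₂', hc₂⟩ := h₂₄.pole_x
  obtain ⟨_, hτ₂', hp₂⟩ := h₂₄.pole_z
  obtain ⟨_, hσ₃', hc₃⟩ := h₃₅.pole_x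
  obtain ⟨_, hτ₃', hq₃⟩ := h₃₅.pole_z
  have typeA_of_pe_rb (hpe : K.p = K.e ∧ K.r = K.b) : K.TypeA :=
    typeA_of_rotate (typeA_of_rotate (hK.rotate.rotate.typeA_of_opposite_eq hpe.1 hpe.2.symm))
  rcases h.quad_x.rotate.signed_sum_eq_zero_or_opposite_eq h₃₅.τ_sq hτ₃' hq₃ h₁₆.τ_sq hτ₁' hq₁
    with hx | ⟨hqd, has⟩
  swap
  · exact .inl (typeA_of_rotate (hK.rotate.typeA_of_opposite_eq hqd has.symm))
  rcases h.quad_y.rotate.signed_sum_eq_zero_or_opposite_eq h₁₆.σ_sq hσ₁' hp₁ h₂₄.τ_sq hτ₂' hp₂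
    with hy | hpe
  swap
  · exact .inl (typeA_of_pe_rb hpe)
  rcases h.quad_z.signed_sum_eq_zero_or_opposite_eq h₃₅.σ_sq hσ₃' hc₃ h₂₄.σ_sq hσ₂' hc₂
    with hz | ⟨hch, hfg⟩
  swap
  · exact .inl (hK.typeA_of_opposite_eq hch hfg)
  exact or_iff_not_imp_left.2 fun hA => ⟨mt typeA_of_pe_rb hA, hx, hy, hz⟩

theorem typeA_or_typeB_of_adjoin_eq (h : K.GenericFlex x y z) (hxz : ℝ⟮x⟯ = ℝ⟮z⟯)
    (hyz : ℝ⟮y⟯ = ℝ⟮z⟯) : K.TypeA ∨ K.TypeB := by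
  have mem_of_eq {u v : L} (huv : ℝ⟮u⟯ = ℝ⟮v⟯) : u ∈ ℝ⟮v⟯ := huv ▸ mem_adjoin_simple_self ℝ u
  have hxy := hxz.trans hyz.symm
  obtain ⟨σ₁, τ₁, k₁, h₁₆⟩ := h.flex₁.exists_isogramPair h.flex₆ h.trans_x h.trans_y
    (mem_of_eq hxy) (mem_of_eq hxy.symm)
  obtain ⟨σ₂, τ₂, k₂, h₂₄⟩ := h.flex₂.exists_isogramPair h.flex₄ h.trans_y h.trans_z
    (mem_of_eq hyz) (mem_of_eq hyz.symm)
  obtain ⟨σ₃, τ₃, k₃, h₃₅⟩ := h.flex₃.exists_isogramPair h.flex₅ h.trans_x h.trans_z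
    (mem_of_eq hxz) (mem_of_eq hxz.symm)
  refine (h.typeA_or_signed_sums_eq_zero h₁₆ h₂₄ h₃₅).imp_right fun ⟨hne, hx, hy, hz⟩ => ?_
  have hK := h.isBalanced h₁₆ h₂₄ h₃₅
  have hsign := h.mul_signs_eq_neg_one h₁₆ h₂₄ h₃₅
  have hB := B_eq_zero_of_signed_sums h₁₆.σ_sq h₂₄.σ_sq h₃₅.σ_sq h₁₆.τ_sq h₂₄.τ_sq h₃₅.τ_sq
    hsign hK hne hx hy hz h₁₆.isogram' h₂₄.isogram
  have sq_eq_one {ε ε' : ℝ} (hε : ε ^ 2 = 1) (hε' : ε' ^ 2 = 1) : (-(ε * ε')) ^ 2 = 1 := by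
    rw [neg_sq, mul_pow, hε, hε', one_mul]
  exact ⟨⟨hK.zeroSum_z, hK.zeroSum_y, hK.zeroSum_x⟩,
    ⟨hK.qge_eq_pfd, hK.bhq_eq_cdr, hK.rga_eq_sfb⟩,
    B_product_eq_zero (sq_eq_one h₃₅.τ_sq h₁₆.τ_sq) (sq_eq_one h₃₅.σ_sq h₂₄.σ_sq)
      (sq_eq_one h₂₄.τ_sq h₁₆.σ_sq) (by linear_combination -hsign) hB⟩

end GenericFlex

end OctahedronMetric

theorem mainTheorem1 (K : OctahedronMetric) (hK : K.NontriviallyFlexible) :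
    K.TypeA ∨ K.TypeB := by
  obtain ⟨L, _, _, x, y, z, h⟩ := hK.exists_genericFlex
  by_cases heq : ℝ⟮x⟯ = ℝ⟮z⟯ ∧ ℝ⟮y⟯ = ℝ⟮z⟯
  · exact h.typeA_or_typeB_of_adjoin_eq heq.1 heq.2
  · exact .inl (h.typeA_of_adjoin_ne heq)
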